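/- Let $G$ be a simply connected nilpotent Lie group of real dimension $2n$, let $\Gamma\subset G$ be a discrete subgroup with $M=\Gamma\backslash G$ compact (a nilmanifold), and let $(J,g)$ be an invariant Hermitian structure on $M$, i.e. one induced by a left-invariant integrable complex structure $J$ and a left-invariant $J$-orthogonal Riemannian metric $g$ on $G$. Let $\Omega$ be the fundamental 2-form, $g(X,Y)=\Omega(X,JY)$, let $\theta=-J\,d^*\Omega$ be the Lee form, where $(J\alpha)(X)=\alpha(JX)$ on 1-forms, and call $g$ balanced if $\theta=0$. Let $\nabla$ be the Bismut connection of $(M,J,g)$, i.e. the unique connection with $\nabla g=0$, $\nabla J=0$ for which $g(X,T(Y,Z))$ is totally skew-symmetric, where $T$ is the torsion of $\nabla$. Then the holonomy of $\nabla$ reduces to $SU(n)$ (the holonomy group at each point is contained in $SU(n)$) if and only if $g$ is balanced. The same holds for every canonical Hermitian connection other than the Chern connection: if $\nabla^{t}=\tfrac{1+t}{2}\nabla^{\mathrm{Ch}}+\tfrac{1-t}{2}\nabla$, $t\in\mathbb R$, where $\nabla^{\mathrm{Ch}}$ is the Chern connection (the unique connection preserving $g$ and $J$ whose torsion has no $(1,1)$-part),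 then for every $t\neq 1$ the holonomy of $\nabla^t$ reduces to $SU(n)$ if and only if $g$ is balanced. -/

import Mathlib

open scoped Manifold ContDiff

noncomputable section

/-! ### Hermitian structures on a Lie algebra -/

/-- A left-invariant Hermitian structure `(J, g)` on a Lie group, given by its value on the Lie
algebra `L` of left-invariant vector fields: an integrable complex structure `J` (its Nijenhuis
tensor vanishes) and a positive definite inner product `g` for which `J` is orthogonal. -/
structure InvariantHermitian (L : Type*) [LieRing L] [LieAlgebra ℝ L] where
  J : L →ₗ[ℝ] L
  J_sq : ∀ X, J (J X) = -X
  integrable : ∀ X Y : L, ⁅J X, J Y⁆ - J ⁅J X, Y⁆ - J ⁅X, J Y⁆ - ⁅X, Y⁆ = 0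
  g : LinearMap.BilinForm ℝ L
  g_symm : ∀ X Y, g X Y = g Y X
  g_pos : ∀ X, X ≠ 0 → 0 < g X X
  g_J : ∀ X Y, g (J X) (J Y) = g X Y

namespace InvariantHermitian

section

variable {L : Type*} [LieRing L] [LieAlgebra ℝ L] (S : InvariantHermitian L)

theorem g_nondegenerate : S.g.Nondegenerate := by
  refine ⟨fun X h => ?_, fun X h => ?_⟩ <;>
  · by_contra hX
    exact (S.g_pos X hX).ne' (h X)

/-- The fundamental 2-form, determined by `g X Y = Ω X (J Y)`. -/
def fundamentalForm (X Y : L) : ℝ := S.g (S.J X) Y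

theorem g_eq_fundamentalForm (X Y : L) : S.g X Y = S.fundamentalForm X (S.J Y) :=
  (S.g_J X Y).symm

variable [FiniteDimensional ℝ L]

/-- The Levi-Civita connection `D_X Y` of the left-invariant metric, for left-invariant `X, Y`,
by the Koszul formula `2 g(D_X Y, Z) = g([X,Y], Z) - g([Y,Z], X) + g([Z,X], Y)`. -/
def leviCivita (X Y : L) : L :=
  (S.g.toDual S.g_nondegenerate).symm
    ((1 / 2 : ℝ) • (S.g ⁅X, Y⁆ - S.g X ∘ₗ (LieAlgebra.ad ℝ L Y : L →ₗ[ℝ] L)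
      - S.g Y ∘ₗ (LieAlgebra.ad ℝ L X : L →ₗ[ℝ] L)))

theorem g_leviCivita (X Y Z : L) :
    2 * S.g (S.leviCivita X Y) Z = S.g ⁅X, Y⁆ Z - S.g ⁅Y, Z⁆ X + S.g ⁅Z, X⁆ Y := by
  have h : S.g ⁅Z, X⁆ Y = -S.g Y ⁅X, Z⁆ := by
    rw [S.g_symm, ← lie_skew Z X, map_neg]
  rw [leviCivita, LinearMap.BilinForm.apply_toDual_symm_apply, h, S.g_symm ⁅Y, Z⁆ X]
  simp only [LinearMap.smul_apply, LinearMap.sub_apply, LinearMap.comp_apply,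
    LieAlgebra.ad_apply, smul_eq_mul]
  ring

/-- The covariant derivative `(D_X Ω)(Y, Z)` of the fundamental form. -/
def covDerivFundamentalForm (X Y Z : L) : ℝ :=
  -S.fundamentalForm (S.leviCivita X Y) Z - S.fundamentalForm Y (S.leviCivita X Z)

/-- The codifferential `d^*Ω`, where `d^*` is the formal adjoint of `d`:
`(d^*Ω)(Y) = -∑ᵢ (D_{eⁱ} Ω)(eᵢ, Y)` for any basis `eᵢ` with `g`-dual basis `eⁱ`
(for instance an orthonormal one). -/
def codiffFundamentalForm (Y : L) : ℝ :=
  -∑ i, S.covDerivFundamentalForm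
    (S.g.dualBasis S.g_nondegenerate (Module.finBasis ℝ L) i) (Module.finBasis ℝ L i) Y

/-- The Lee form `θ = -J d^*Ω`, with `(J α)(X) = α (J X)` on 1-forms. -/
def leeForm (X : L) : ℝ := -S.codiffFundamentalForm (S.J X)

/-- The metric is balanced if its Lee form vanishes. -/
def IsBalanced : Prop := ∀ X, S.leeForm X = 0

end

section

variable {L : Type*} [LieRing L] [LieAlgebra ℝ L] (S : InvariantHermitian L)

/-- `e` is a unitary frame of `(L, J, g)`: the vectors `e₁, J e₁, …, eₙ, J eₙ` form a
`g`-orthonormal basis. -/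
def IsUnitaryFrame {n : ℕ} (e : Fin n → L) : Prop :=
  (∀ i j, S.g (e i) (e j) = if i = j then 1 else 0) ∧
  (∀ i j, S.g (e i) (S.J (e j)) = 0) ∧
  Submodule.span ℝ (Set.range e ∪ Set.range fun i => S.J (e i)) = ⊤

/-- The endomorphism `A` belongs to `SU(n) = SU(L, J, g)`: it is `J`-linear and its complex matrix
in a unitary frame lies in `SU(n)`. -/
def IsSpecialUnitary (n : ℕ) (A : L →ₗ[ℝ] L) : Prop :=
  (∀ X, A (S.J X) = S.J (A X)) ∧
  ∃ e : Fin n → L, S.IsUnitaryFrame e ∧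
    ∃ U ∈ Matrix.specialUnitaryGroup (Fin n) ℂ,
      ∀ j, A (e j) = ∑ i, ((U i j).re • e i + (U i j).im • S.J (e i))

end

end InvariantHermitian

/-! ### Nilmanifolds, connections, holonomy -/

instance instLieGroupMinSmoothnessThree {m : ℕ} {G : Type*} [TopologicalSpace G]
    [ChartedSpace (EuclideanSpace ℝ (Fin m)) G] [Group G] [LieGroup (𝓡 m) ∞ G] :
    LieGroup (𝓡 m) (minSmoothness ℝ 3) G := by
  rw [minSmoothness_of_isRCLikeNormedField]
  infer_instance

instance instFiniteDimensionalGroupLieAlgebra {m : ℕ} {G : Type*} [TopologicalSpace G]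
    [ChartedSpace (EuclideanSpace ℝ (Fin m)) G] [Group G] :
    FiniteDimensional ℝ (GroupLieAlgebra (𝓡 m) G) :=
  inferInstanceAs (FiniteDimensional ℝ (EuclideanSpace ℝ (Fin m)))

/-- The quotient `Γ\G` by the left translations by elements of `Γ`, with the quotient topology. -/
abbrev LeftQuotient {G : Type*} [Group G] (Γ : Subgroup G) : Type _ :=
  Quotient (QuotientGroup.rightRel Γ)

/-- The projection `G → Γ\G`. -/
def LeftQuotient.mk {G : Type*} [Group G] (Γ : Subgroup G) (x : G) : LeftQuotient Γ :=
  Quotient.mk (QuotientGroup.rightRel Γ) x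

/-- A vector of the Lie algebra of `G`, as an element of the (definitionally equal) normed space on
which `G` is modelled. -/
def toModel {m : ℕ} {G : Type*} [TopologicalSpace G]
    [ChartedSpace (EuclideanSpace ℝ (Fin m)) G] [Group G]
    (v : GroupLieAlgebra (𝓡 m) G) : EuclideanSpace ℝ (Fin m) := v

/-- A smooth connection `∇` on the tangent bundle of `M = Γ\G`, for `Γ` discrete. The left-invariant
vector fields of `G` descend to `M` and trivialize `TM = M × 𝔤`; the connection is given by its
(arbitrary, not necessarily constant) connection form `p ↦ (X ↦ (Y ↦ (∇_X Y)(p)))` in this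
trivialization, where `X, Y ∈ 𝔤` are regarded as vector fields on `M`. Smoothness of a function on
`M` is smoothness of its pull-back to `G`, as `G → M` is a covering. -/
structure NilConnection {m : ℕ} {G : Type*} [TopologicalSpace G]
    [ChartedSpace (EuclideanSpace ℝ (Fin m)) G] [Group G] (Γ : Subgroup G) where
  form : LeftQuotient Γ →
    GroupLieAlgebra (𝓡 m) G →ₗ[ℝ] GroupLieAlgebra (𝓡 m) G →ₗ[ℝ] GroupLieAlgebra (𝓡 m) G
  smooth : ∀ X Y : GroupLieAlgebra (𝓡 m) G,
    ContMDiff (𝓡 m) 𝓘(ℝ, EuclideanSpace ℝ (Fin m)) ∞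
      (fun x : G => toModel (form (LeftQuotient.mk Γ x) X Y))

namespace NilConnection

variable {m : ℕ} {G : Type*} [TopologicalSpace G]
    [ChartedSpace (EuclideanSpace ℝ (Fin m)) G] [Group G] {Γ : Subgroup G}

/-- `IsTransport ∇ x y A`: there is a smooth curve `c` in `G` from `c 0 = x` to `c 1 = y` such that
`A` is the `∇`-parallel transport along the projection of `c` to `Γ\G`. Here `u t ∈ 𝔤` is
the velocity of `c` in the left-invariant frame, and for each `v ∈ 𝔤` the vector field
`t ↦ Φ t v` along the curve is parallel with initial value `v`. -/
def IsTransport (D : NilConnection (m := m) Γ) (x y : G)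
    (A : GroupLieAlgebra (𝓡 m) G →ₗ[ℝ] GroupLieAlgebra (𝓡 m) G) : Prop :=
  ∃ (c : ℝ → G) (u : ℝ → GroupLieAlgebra (𝓡 m) G)
    (Φ : ℝ → GroupLieAlgebra (𝓡 m) G →ₗ[ℝ] GroupLieAlgebra (𝓡 m) G),
    ContMDiff 𝓘(ℝ, ℝ) (𝓡 m) ∞ c ∧ c 0 = x ∧ c 1 = y ∧
    (∀ t : ℝ, mfderiv 𝓘(ℝ, ℝ) (𝓡 m) c t (1 : ℝ) = mulInvariantVectorField (u t) (c t)) ∧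
    Φ 0 = LinearMap.id ∧ Φ 1 = A ∧
    ∀ (v : GroupLieAlgebra (𝓡 m) G) (t : ℝ),
      HasDerivAt (fun s => toModel (Φ s v))
        (-toModel (D.form (LeftQuotient.mk Γ (c t)) (u t) (Φ t v))) t

/-- Parallel transport along (projections to `Γ\G` of) piecewise smooth curves. -/
inductive IsPiecewiseTransport (D : NilConnection (m := m) Γ) (x : G) :
    G → (GroupLieAlgebra (𝓡 m) G →ₗ[ℝ] GroupLieAlgebra (𝓡 m) G) → Prop
  | refl : IsPiecewiseTransport D x x LinearMap.id
  | tail {y z : G} {A B : GroupLieAlgebra (𝓡 m) G →ₗ[ℝ] GroupLieAlgebra (𝓡 m) G} :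
      IsPiecewiseTransport D x y A → D.IsTransport y z B → IsPiecewiseTransport D x z (B ∘ₗ A)

/-- The holonomy group of `∇` at the point `Γx` of `Γ\G`: parallel transports along piecewise
smooth loops, i.e. along projections of piecewise smooth curves in `G` whose end points have the
same image in `Γ\G`. -/
def holonomy (D : NilConnection (m := m) Γ) (x : G) :
    Set (GroupLieAlgebra (𝓡 m) G →ₗ[ℝ] GroupLieAlgebra (𝓡 m) G) :=
  {A | ∃ y : G, LeftQuotient.mk Γ y = LeftQuotient.mk Γ x ∧ D.IsPiecewiseTransport x y A}

variable [LieGroup (𝓡 m) ∞ G]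

/-- The holonomy of `∇` reduces to `SU(n)`: at every point, it is contained in `SU(n)`. -/
def HolonomyReducesToSU (D : NilConnection (m := m) Γ)
    (S : InvariantHermitian (GroupLieAlgebra (𝓡 m) G)) (n : ℕ) : Prop :=
  ∀ x : G, ∀ A ∈ D.holonomy x, S.IsSpecialUnitary n A

/-- The torsion `T(X, Y) = ∇_X Y - ∇_Y X - [X, Y]` at the point `p`. -/
def torsion (D : NilConnection (m := m) Γ) (p : LeftQuotient Γ)
    (X Y : GroupLieAlgebra (𝓡 m) G) : GroupLieAlgebra (𝓡 m) G :=
  D.form p X Y - D.form p Y X - ⁅X, Y⁆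

/-- `∇` is a Hermitian connection: `∇g = 0` and `∇J = 0`. -/
def IsHermitian (D : NilConnection (m := m) Γ)
    (S : InvariantHermitian (GroupLieAlgebra (𝓡 m) G)) : Prop :=
  (∀ p X Y Z, S.g (D.form p X Y) Z + S.g Y (D.form p X Z) = 0) ∧
  (∀ p X Y, D.form p X (S.J Y) = S.J (D.form p X Y))

/-- `∇` is the Bismut connection: the Hermitian connection for which
`g(X, T(Y, Z))` is totally skew-symmetric. -/
def IsBismut (D : NilConnection (m := m) Γ)
    (S : InvariantHermitian (GroupLieAlgebra (𝓡 m) G)) : Prop :=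
  D.IsHermitian S ∧ ∀ p X Y Z, S.g X (D.torsion p Y Z) = -S.g Y (D.torsion p X Z)

/-- `∇` is the Chern connection: the Hermitian connection whose torsion has vanishing
`(1,1)`-part. -/
def IsChern (D : NilConnection (m := m) Γ)
    (S : InvariantHermitian (GroupLieAlgebra (𝓡 m) G)) : Prop :=
  D.IsHermitian S ∧ ∀ p X Y, D.torsion p (S.J X) (S.J Y) = -D.torsion p X Y

/-- `∇` is the member `∇ᵗ` of the 1-parameter family of canonical Hermitian connections (the
affine line through the Chern connection `∇¹` and the Bismut connection `∇⁻¹`). -/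
def IsCanonical (D : NilConnection (m := m) Γ)
    (S : InvariantHermitian (GroupLieAlgebra (𝓡 m) G)) (t : ℝ) : Prop :=
  ∃ C B : NilConnection (m := m) Γ, C.IsChern S ∧ B.IsBismut S ∧
    ∀ p X Y, D.form p X Y = ((1 + t) / 2) • C.form p X Y + ((1 - t) / 2) • B.form p X Y

end NilConnection

end

/-! For a Hermitian connection, `D X` is skew and `J`-linear, so its complex trace is `-(i/2) tr(J ∘
D X)`. By Jacobi's formula the complex determinant of parallel transport is governed by the trace
form `X ↦ tr(J ∘ D X)` alone; metric and `J` are preserved anyway. The theorem thus splits into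
computing this form and deciding when it has trivial determinant holonomy.

Computation. Nilpotency kills `tr(ad X)`, and also `tr(J ∘ ad X)`: integrability makes `ad X + J
ad(J X)` commute with `J`, whence it is nilpotent too. Hence the trace form is expressed by the
torsion alone (`IsHermitianForm.trace_J`). It is zero for Chern and `-2 d^*Ω` for Bismut, so by
affinity `-(1 - t) d^*Ω` for `∇ᵗ`.

If `d^*Ω = 0`, determinants of transports are constant and the holonomy lies in `SU(n)`. Conversely,
suppose the holonomy lies in `SU(n)`. Around a loop the determinant is `exp((i/2) ∫ α)`, with `α`
the trace form, so `∫ α` lies in `4πℤ`; for short loops it is small, hence zero. Shrinking ellipses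
at the identity give `dα = 0` there, that is, `α` vanishes on brackets (`trace_lie_eq_zero`). But
nilpotency also gives `2 d^*Ω = g(∑ [J bᵢ, bᵢ], ·)`: the dual vector of `d^*Ω` is itself a sum of
brackets, so it is orthogonal to itself and vanishes (`codiff_eq_zero`). -/

noncomputable section

namespace InvariantHermitian

/-! ### Orthonormal bases and bilinear maps on the Lie algebra -/

section Algebra

variable {L : Type*} [LieRing L] [LieAlgebra ℝ L] (S : InvariantHermitian L)

theorem g_J_left (X Y : L) : S.g (S.J X) Y = -S.g X (S.J Y) := by
  rw [← S.g_J X (S.J Y), S.J_sq, map_neg, neg_neg]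

/-- `b` is a `g`-orthonormal family. -/
def IsOrthonormal {ι : Type*} [DecidableEq ι] (b : ι → L) : Prop :=
  ∀ i j, S.g (b i) (b j) = if i = j then 1 else 0

variable {S}

theorem IsOrthonormal.repr_eq {ι : Type*} [Fintype ι] [DecidableEq ι] {b : Module.Basis ι ℝ L}
    (hb : S.IsOrthonormal b) (X : L) (i : ι) : b.repr X i = S.g (b i) X := by
  conv_rhs => rw [← b.sum_repr X]
  rw [map_sum]
  simp [-Module.Basis.sum_repr, show ∀ j, S.g (b i) (b j) = _ from hb i]

theorem IsOrthonormal.sum_smul {ι : Type*} [Fintype ι] [DecidableEq ι] {b : Module.Basis ι ℝ L}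
    (hb : S.IsOrthonormal b) (X : L) : ∑ i, S.g (b i) X • b i = X := by
  simp_rw [← hb.repr_eq]
  exact b.sum_repr X

theorem IsOrthonormal.trace_eq {ι : Type*} [Fintype ι] [DecidableEq ι] {b : Module.Basis ι ℝ L}
    (hb : S.IsOrthonormal b) (A : L →ₗ[ℝ] L) :
    LinearMap.trace ℝ L A = ∑ i, S.g (b i) (A (b i)) := by
  rw [LinearMap.trace_eq_matrix_trace ℝ b, Matrix.trace]
  simp [LinearMap.toMatrix_apply, hb.repr_eq]

/-- Metric contraction is independent of the basis; this frees the codifferential from the arbitrary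
basis in its definition. -/
theorem IsOrthonormal.sum_dualBasis {ι κ : Type*} [Fintype ι] [DecidableEq ι] [Fintype κ]
    [DecidableEq κ] {b : Module.Basis ι ℝ L} (hb : S.IsOrthonormal b) (c : Module.Basis κ ℝ L)
    [FiniteDimensional ℝ L] (F : L →ₗ[ℝ] L →ₗ[ℝ] ℝ) :
    ∑ k, F (S.g.dualBasis S.g_nondegenerate c k) (c k) = ∑ i, F (b i) (b i) := by
  have h1 : ∀ k, F (S.g.dualBasis S.g_nondegenerate c k) (c k)
      = ∑ i, F (S.g (b i) (c k) • S.g.dualBasis S.g_nondegenerate c k) (b i) := by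
    intro k
    conv_lhs => rw [← hb.sum_smul (c k)]
    simp
  rw [Finset.sum_congr rfl fun k _ => h1 k, Finset.sum_comm]
  refine Finset.sum_congr rfl fun i _ => ?_
  rw [← LinearMap.sum_apply, ← map_sum]
  congr 2
  have h2 := (S.g.dualBasis S.g_nondegenerate c).sum_repr (b i)
  simpa [LinearMap.BilinForm.dualBasis_repr_apply] using h2

variable (S)

/-- A bilinear map `D` is Hermitian if every `D X` is skew-symmetric and `J`-linear. -/
def IsHermitianForm (D : L →ₗ[ℝ] L →ₗ[ℝ] L) : Prop :=
  (∀ X Y Z, S.g (D X Y) Z + S.g Y (D X Z) = 0) ∧ ∀ X Y, D X (S.J Y) = S.J (D X Y)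

/-- The torsion of a bilinear map, as an invariant connection. -/
def torsionForm (D : L →ₗ[ℝ] L →ₗ[ℝ] L) : L →ₗ[ℝ] L →ₗ[ℝ] L :=
  D - D.flip - (LieAlgebra.ad ℝ L : L →ₗ[ℝ] L →ₗ[ℝ] L)

theorem torsionForm_apply (D : L →ₗ[ℝ] L →ₗ[ℝ] L) (X Y : L) :
    torsionForm D X Y = D X Y - D Y X - ⁅X, Y⁆ := by
  simp [torsionForm]

/-! ### Traces of `ad X` and `J ∘ ad X` on a nilpotent Lie algebra -/

section Nilpotent

/-- The operator `ad X + J ad (J X)`. -/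
def adBar (X : L) : L →ₗ[ℝ] L :=
  (LieAlgebra.ad ℝ L X : L →ₗ[ℝ] L) + S.J ∘ₗ (LieAlgebra.ad ℝ L (S.J X) : L →ₗ[ℝ] L)

theorem adBar_apply (X Y : L) : S.adBar X Y = ⁅X, Y⁆ + S.J ⁅S.J X, Y⁆ := by
  simp [adBar]

/-- This is the vanishing of the Nijenhuis tensor, rewritten. -/
theorem adBar_J (X Y : L) : S.adBar X (S.J Y) = S.J (S.adBar X Y) := by
  have h := S.integrable X Y
  have h2 : ⁅S.J X, S.J Y⁆ = S.J ⁅S.J X, Y⁆ + S.J ⁅X, S.J Y⁆ + ⁅X, Y⁆ := by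
    rw [← sub_eq_zero, ← h]; abel
  simp only [adBar_apply, h2, map_add, S.J_sq]
  abel

/-- The terms of the lower central series need not be `J`-stable, but `Cᵏ + J Cᵏ` is; by
`J`-linearity `adBar X` sends it into the next one. -/
theorem adBar_pow_mem (X : L) (k : ℕ) (Y : L) :
    ∃ U ∈ LieModule.lowerCentralSeries ℝ L L k, ∃ V ∈ LieModule.lowerCentralSeries ℝ L L k,
      (S.adBar X ^ k) Y = U + S.J V := by
  induction k with
  | zero => exact ⟨Y, by simp, 0, by simp, by simp⟩
  | succ k ih =>
    obtain ⟨U, hU, V, hV, h⟩ := ih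
    have hm : ∀ Z W, W ∈ LieModule.lowerCentralSeries ℝ L L k →
        ⁅Z, W⁆ ∈ LieModule.lowerCentralSeries ℝ L L (k + 1) := fun Z W hW => by
      rw [LieModule.lowerCentralSeries_succ]
      exact LieSubmodule.lie_mem_lie (LieSubmodule.mem_top Z) hW
    refine ⟨⁅X, U⁆ - ⁅S.J X, V⁆, sub_mem (hm _ _ hU) (hm _ _ hV),
      ⁅S.J X, U⁆ + ⁅X, V⁆, add_mem (hm _ _ hU) (hm _ _ hV), ?_⟩
    rw [pow_succ', Module.End.mul_apply, h, map_add, adBar_J]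
    simp only [adBar_apply, map_add, S.J_sq]
    abel

variable [LieRing.IsNilpotent L]

theorem isNilpotent_adBar (X : L) : IsNilpotent (S.adBar X) := by
  obtain ⟨k, hk⟩ := (LieModule.isNilpotent_iff ℝ L L).1 inferInstance
  refine ⟨k, LinearMap.ext fun Y => ?_⟩
  obtain ⟨U, hU, V, hV, h⟩ := S.adBar_pow_mem X k Y
  rw [hk, LieSubmodule.mem_bot] at hU hV
  rw [h, hU, hV]
  simp

theorem trace_ad_eq_zero [FiniteDimensional ℝ L] (X : L) :
    LinearMap.trace ℝ L (LieAlgebra.ad ℝ L X : L →ₗ[ℝ] L) = 0 := by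
  have h : IsNilpotent (LieAlgebra.ad ℝ L X) := by
    obtain ⟨k, hk⟩ := LieModule.exists_forall_pow_toEnd_eq_zero ℝ L L
    exact ⟨k, hk X⟩
  exact (LinearMap.isNilpotent_trace_of_isNilpotent h).eq_zero

theorem trace_J_ad_eq_zero [FiniteDimensional ℝ L] (X : L) :
    LinearMap.trace ℝ L (S.J ∘ₗ (LieAlgebra.ad ℝ L X : L →ₗ[ℝ] L)) = 0 := by
  -- As `J(-J X) = X`, this operator is `-ad(J X) + J ∘ ad X`, whose first term is traceless.
  have h := (LinearMap.isNilpotent_trace_of_isNilpotent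
    (S.isNilpotent_adBar (-S.J X))).eq_zero
  rw [adBar, map_add, trace_ad_eq_zero, zero_add] at h
  simpa [S.J_sq] using h

end Nilpotent

/-! ### Trace forms of Hermitian connections and the codifferential -/

section Trace

variable {S}
variable {ι : Type*} [Fintype ι] [DecidableEq ι] {b : Module.Basis ι ℝ L}

theorem IsOrthonormal.trace_eq_zero_of_skew (hb : S.IsOrthonormal b) {A : L →ₗ[ℝ] L}
    (hA : ∀ X, S.g X (A X) = 0) : LinearMap.trace ℝ L A = 0 := by
  simp [hb.trace_eq, hA]

theorem IsHermitianForm.g_self {D : L →ₗ[ℝ] L →ₗ[ℝ] L} (hD : S.IsHermitianForm D) (X Y : L) :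
    S.g Y (D X Y) = 0 := by
  have := hD.1 X Y Y
  rw [S.g_symm] at this
  linarith

theorem IsHermitianForm.trace_J (hb : S.IsOrthonormal b) [LieRing.IsNilpotent L]
    {D : L →ₗ[ℝ] L →ₗ[ℝ] L} (hD : S.IsHermitianForm D) (X : L) :
    LinearMap.trace ℝ L (S.J ∘ₗ D X) =
      LinearMap.trace ℝ L (S.J ∘ₗ torsionForm D X)
        - LinearMap.trace ℝ L (torsionForm D (S.J X)) := by
  have : FiniteDimensional ℝ L := b.finiteDimensional_of_finite
  -- Comparing `T(J X, Y)` with `J T(X, Y)`, the terms `D Y (J X)` and `J (D Y X)` cancel since `D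
  -- Y` is `J`-linear.
  have h : D (S.J X) - S.J ∘ₗ D X = (LieAlgebra.ad ℝ L (S.J X) : L →ₗ[ℝ] L)
      - S.J ∘ₗ (LieAlgebra.ad ℝ L X : L →ₗ[ℝ] L) + torsionForm D (S.J X)
      - S.J ∘ₗ torsionForm D X := by
    ext Y
    simp [torsionForm_apply, hD.2]
  have h2 := congrArg (LinearMap.trace ℝ L) h
  simp only [map_add, map_sub, trace_ad_eq_zero, S.trace_J_ad_eq_zero] at h2
  rw [hb.trace_eq_zero_of_skew (A := D (S.J X)) fun Y => hD.g_self _ Y] at h2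
  linarith

/-- Without a `(1,1)`-part, and with `J` integrable, the torsion is complex bilinear, so the two
torsion traces in `trace_J` cancel. -/
theorem IsHermitianForm.trace_J_of_chern (hb : S.IsOrthonormal b) [LieRing.IsNilpotent L]
    {D : L →ₗ[ℝ] L →ₗ[ℝ] L} (hD : S.IsHermitianForm D)
    (hT : ∀ X Y, torsionForm D (S.J X) (S.J Y) = -torsionForm D X Y) (X : L) :
    LinearMap.trace ℝ L (S.J ∘ₗ D X) = 0 := by
  have h : S.J ∘ₗ torsionForm D X = torsionForm D (S.J X) := by
    ext Y
    have h1 : torsionForm D (S.J X) Y = torsionForm D X (S.J Y) := by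
      have := hT X (S.J Y)
      rw [S.J_sq, map_neg, neg_inj] at this
      exact this
    -- Since `D` is `J`-linear, this combination of torsions is minus the Nijenhuis tensor.
    have h2 : torsionForm D (S.J X) (S.J Y) - S.J (torsionForm D (S.J X) Y)
        - S.J (torsionForm D X (S.J Y)) - torsionForm D X Y = 0 := by
      rw [← neg_zero (G := L), ← S.integrable X Y]
      simp only [torsionForm_apply, hD.2, map_sub, S.J_sq]
      abel
    rw [hT, ← h1] at h2
    have h3 : (2 : ℝ) • S.J (torsionForm D (S.J X) Y) = -((2 : ℝ) • torsionForm D X Y) := by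
      rw [two_smul, two_smul, ← sub_eq_zero, ← neg_zero (G := L), ← h2]
      abel
    rw [← smul_neg] at h3
    have h4 := smul_right_injective L (two_ne_zero (α := ℝ)) h3
    have h5 := congrArg S.J h4
    rw [S.J_sq, map_neg, neg_inj] at h5
    exact h5.symm
  rw [hD.trace_J hb, h, sub_self]

theorem IsOrthonormal.codiff_eq [FiniteDimensional ℝ L] (hb : S.IsOrthonormal b) (Z : L) :
    S.codiffFundamentalForm Z = -∑ i, S.covDerivFundamentalForm (b i) (b i) Z := by
  -- Bilinearity follows from the Koszul formula and nondegeneracy; it is needed to treat the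
  -- summand as a bilinear form.
  have hlc : ∃ N : L →ₗ[ℝ] L →ₗ[ℝ] L, ∀ X Y, N X Y = S.leviCivita X Y := by
    have hg : ∀ W W' : L, (∀ Z, S.g W Z = S.g W' Z) → W = W' := fun W W' h => by
      rw [← sub_eq_zero]
      exact S.g_nondegenerate.1 _ fun Z => by simp [h]
    refine ⟨LinearMap.mk₂ ℝ S.leviCivita ?_ ?_ ?_ ?_, fun X Y => rfl⟩ <;>
    · intros
      refine hg _ _ fun Z => mul_left_cancel₀ (two_ne_zero (α := ℝ)) ?_
      simp only [map_add, LinearMap.add_apply, mul_add, map_smul, LinearMap.smul_apply,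
        smul_eq_mul, mul_left_comm (2 : ℝ), S.g_leviCivita, add_lie, lie_add, smul_lie, lie_smul]
      ring
  obtain ⟨N, hN⟩ := hlc
  let F : L →ₗ[ℝ] L →ₗ[ℝ] ℝ := LinearMap.mk₂ ℝ (fun X Y => S.covDerivFundamentalForm X Y Z)
    (by intros; simp only [covDerivFundamentalForm, fundamentalForm, ← hN, map_add,
          LinearMap.add_apply]; ring)
    (by intros; simp only [covDerivFundamentalForm, fundamentalForm, ← hN, map_smul,
          LinearMap.smul_apply, smul_eq_mul]; ring)
    (by intros; simp only [covDerivFundamentalForm, fundamentalForm, ← hN, map_add,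
          LinearMap.add_apply]; ring)
    (by intros; simp only [covDerivFundamentalForm, fundamentalForm, ← hN, map_smul,
          LinearMap.smul_apply, smul_eq_mul]; ring)
  exact congrArg Neg.neg (hb.sum_dualBasis (Module.finBasis ℝ L) F)

/-- Total skewness makes `tr T(J Z)` vanish. As `D` preserves `Ω`, the Levi-Civita derivative of `Ω`
only sees the torsion, and its contraction is the remaining trace `tr(J ∘ T Z)`. -/
theorem IsHermitianForm.trace_J_of_bismut [FiniteDimensional ℝ L] (hb : S.IsOrthonormal b)
    [LieRing.IsNilpotent L] {D : L →ₗ[ℝ] L →ₗ[ℝ] L} (hD : S.IsHermitianForm D)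
    (hT : ∀ X Y Z, S.g X (torsionForm D Y Z) = -S.g Y (torsionForm D X Z)) (Z : L) :
    LinearMap.trace ℝ L (S.J ∘ₗ D Z) = -2 * S.codiffFundamentalForm Z := by
  have hTs : ∀ X Y, torsionForm D X Y = -torsionForm D Y X := fun X Y => by
    simp only [torsionForm_apply, ← lie_skew X Y]; abel
  have hT0 : ∀ X Y, S.g Y (torsionForm D X Y) = 0 := fun X Y => by
    have h1 := hT Y X Y
    have h2 : torsionForm D Y Y = 0 := by simp [torsionForm_apply]
    simpa [h2] using h1
  -- A metric connection with skew torsion is Levi-Civita plus half its torsion.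
  have hlc : ∀ X Y W, 2 * S.g (S.leviCivita X Y) W
      = 2 * S.g (D X Y) W - S.g W (torsionForm D X Y) := by
    intro X Y W
    have e1 : ∀ X Y, ⁅X, Y⁆ = D X Y - D Y X - torsionForm D X Y := fun X Y => by
      rw [torsionForm_apply]; abel
    have t1 := hT W X Y
    have t2 := hT X Y W
    have t3 := hT Y W X
    rw [hTs W Y, map_neg] at t1
    rw [hTs X W, map_neg] at t2
    have m1 := hD.1 X Y W
    have m2 := hD.1 Y W X
    have m3 := hD.1 W X Y
    rw [S.g_leviCivita]
    simp only [e1, map_sub, LinearMap.sub_apply]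
    rw [S.g_symm Y] at m1
    rw [S.g_symm W] at m2
    rw [S.g_symm X] at m3
    rw [S.g_symm (torsionForm D X Y), S.g_symm (torsionForm D Y W), S.g_symm (torsionForm D W X)]
    linarith
  rw [hD.trace_J hb, hb.trace_eq_zero_of_skew (A := torsionForm D (S.J Z)) fun Y => hT0 _ Y,
    sub_zero, hb.trace_eq, hb.codiff_eq, mul_neg, neg_mul, neg_neg, Finset.mul_sum]
  refine Finset.sum_congr rfl fun i _ => ?_
  have a1 := hlc (b i) (b i) (S.J Z)
  have a2 := hlc (b i) Z (S.J (b i))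
  have a3 : torsionForm D (b i) (b i) = 0 := by simp [torsionForm_apply]
  have a4 := hD.1 (b i) (b i) (S.J Z)
  rw [a3, map_zero] at a1
  rw [covDerivFundamentalForm, fundamentalForm, fundamentalForm, S.g_J_left,
    S.g_symm (S.J (b i)) (S.leviCivita _ _), LinearMap.comp_apply, hTs Z, map_neg, map_neg]
  have a5 := S.g_J_left (b i) (torsionForm D (b i) Z)
  rw [hD.2, ← neg_eq_iff_eq_neg.2 (S.g_J_left (b i) _), S.g_symm (S.J (b i))] at a4
  linarith

/-- Expanding by Koszul leaves, besides the bracket sum, only multiples of `tr ad(J Z)`, `tr(J ∘ ad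
Z)` and `tr(ad Z ∘ J)`, all zero by nilpotency. -/
theorem IsOrthonormal.codiff_eq_g_lie [FiniteDimensional ℝ L] [LieRing.IsNilpotent L]
    (hb : S.IsOrthonormal b) (Z : L) :
    2 * S.codiffFundamentalForm Z = S.g (∑ i, ⁅S.J (b i), b i⁆) Z := by
  have t1 := S.trace_J_ad_eq_zero Z
  have t2 : LinearMap.trace ℝ L ((LieAlgebra.ad ℝ L Z : L →ₗ[ℝ] L) ∘ₗ S.J) = 0 := by
    rw [LinearMap.trace_comp_comm', t1]
  have t3 := trace_ad_eq_zero (S.J Z)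
  rw [hb.trace_eq] at t1 t2 t3
  have key : ∀ i, 2 * S.covDerivFundamentalForm (b i) (b i) Z
      = 2 * S.g (b i) ⁅S.J Z, b i⁆ - S.g (b i) (S.J ⁅Z, b i⁆) + S.g (b i) ⁅Z, S.J (b i)⁆
        - S.g ⁅S.J (b i), b i⁆ Z := by
    intro i
    have a1 := S.g_leviCivita (b i) (b i) (S.J Z)
    have a2 := S.g_leviCivita (b i) Z (S.J (b i))
    rw [lie_self, map_zero, LinearMap.zero_apply, ← lie_skew (b i) (S.J Z), map_neg,
      LinearMap.neg_apply, S.g_symm _ (b i)] at a1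
    rw [← lie_skew (b i) Z, map_neg, LinearMap.neg_apply, S.g_symm ⁅Z, b i⁆, S.g_J_left (b i),
      S.g_symm ⁅Z, S.J (b i)⁆] at a2
    rw [covDerivFundamentalForm, fundamentalForm, fundamentalForm, S.g_J_left,
      S.g_symm (S.J (b i)) (S.leviCivita _ _)]
    linarith
  rw [hb.codiff_eq, mul_neg, Finset.mul_sum, Finset.sum_congr rfl fun i _ => key i]
  simp only [Finset.sum_sub_distrib, Finset.sum_add_distrib, ← Finset.mul_sum, map_sum,
    LinearMap.sum_apply]
  simp only [LinearMap.comp_apply, LieAlgebra.ad_apply] at t1 t2 t3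
  rw [t1, t2, t3]
  ring

theorem IsOrthonormal.codiff_eq_zero [FiniteDimensional ℝ L] [LieRing.IsNilpotent L]
    (hb : S.IsOrthonormal b) (h : ∀ X Y : L, S.codiffFundamentalForm ⁅X, Y⁆ = 0) (Z : L) :
    S.codiffFundamentalForm Z = 0 := by
  have h2 : S.g (∑ i, ⁅S.J (b i), b i⁆) (∑ i, ⁅S.J (b i), b i⁆) = 0 := by
    rw [map_sum (S.g _)]
    exact Finset.sum_eq_zero fun i _ => by rw [← hb.codiff_eq_g_lie, h, mul_zero]
  have h3 : (∑ i, ⁅S.J (b i), b i⁆) = 0 := by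
    by_contra h0
    exact (S.g_pos _ h0).ne' h2
  have := hb.codiff_eq_g_lie Z
  rw [h3] at this
  simpa using this

variable (S) in
theorem isBalanced_iff [FiniteDimensional ℝ L] :
    S.IsBalanced ↔ ∀ X, S.codiffFundamentalForm X = 0 := by
  constructor
  · intro h X
    have := h (-S.J X)
    rw [leeForm, map_neg, S.J_sq, neg_neg] at this
    linarith
  · intro h X
    rw [leeForm, h, neg_zero]

end Trace

end Algebra

end InvariantHermitian

/-! ### Jacobi's formula -/

section Determinant

open Matrix in
/-- Jacobi's formula along a solution of a linear differential equation. -/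
theorem hasDerivAt_det_of_linear {ι : Type*} [Fintype ι] [DecidableEq ι]
    {U : ℝ → Matrix ι ι ℂ} {W : Matrix ι ι ℂ} {t : ℝ}
    (h : ∀ i j, HasDerivAt (fun s => U s i j) (-(W * U t) i j) t) :
    HasDerivAt (fun s => (U s).det) (-W.trace * (U t).det) t := by
  have h1 : HasDerivAt (fun s => (U s).det)
      (∑ σ : Equiv.Perm ι, (Equiv.Perm.sign σ : ℤ) •
        ∑ i, (∏ j ∈ Finset.univ.erase i, U t (σ j) j) • -(W * U t) (σ i) i) t := by
    simp_rw [det_apply]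
    refine HasDerivAt.fun_sum fun σ _ => ?_
    exact (HasDerivAt.fun_finsetProd fun i _ => h (σ i) i).const_smul (Equiv.Perm.sign σ : ℤ)
  convert! h1 using 1
  -- The Leibniz terms in which column `i` is differentiated form the determinant with that column
  -- replaced; Cramer's rule then evaluates it by the adjugate.
  have h2 : ∀ i, ∑ σ : Equiv.Perm ι, (Equiv.Perm.sign σ : ℤ) •
      ((∏ j ∈ Finset.univ.erase i, U t (σ j) j) • -(W * U t) (σ i) i)
      = ((U t).updateCol i fun k => -(W * U t) k i).det := by
    intro i
    rw [det_apply]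
    refine Finset.sum_congr rfl fun σ _ => ?_
    rw [← Finset.prod_erase_mul _ _ (Finset.mem_univ i), updateCol_self]
    congr 2
    refine Finset.prod_congr rfl fun j hj => ?_
    rw [updateCol_ne (Finset.ne_of_mem_erase hj)]
  simp_rw [Finset.smul_sum]
  rw [Finset.sum_comm, Finset.sum_congr rfl fun i _ => h2 i]
  have h3 : ∀ i, ((U t).updateCol i fun k => -(W * U t) k i).det
      = -((U t).adjugate * (W * U t)) i i := by
    intro i
    rw [← cramer_apply, cramer_eq_adjugate_mulVec, mulVec, Matrix.mul_apply]
    simp [dotProduct]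
  rw [Finset.sum_congr rfl fun i _ => h3 i, Finset.sum_neg_distrib, neg_mul, neg_inj]
  change _ = ((U t).adjugate * (W * U t)).trace
  rw [trace_mul_comm, Matrix.mul_assoc, mul_adjugate, mul_smul_comm, Matrix.mul_one, trace_smul,
    smul_eq_mul, mul_comm]

end Determinant

namespace InvariantHermitian

/-! ### Unitary frames and complex matrices -/

section Frames

variable {L : Type*} [LieRing L] [LieAlgebra ℝ L] (S : InvariantHermitian L)

/-- The Hermitian form of `(J, g)`, complex linear in the second variable. -/
def herm (X Y : L) : ℂ := ⟨S.g X Y, S.g (S.J X) Y⟩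

theorem herm_J_right (X Y : L) : S.herm X (S.J Y) = Complex.I * S.herm X Y := by
  apply Complex.ext <;> simp [herm, S.g_J, S.g_J_left]

theorem herm_add_right (X Y Z : L) : S.herm X (Y + Z) = S.herm X Y + S.herm X Z := by
  apply Complex.ext <;> simp [herm]

theorem herm_smul_right (r : ℝ) (X Y : L) : S.herm X (r • Y) = r * S.herm X Y := by
  apply Complex.ext <;> simp [herm]

theorem herm_sum_right {ι : Type*} (s : Finset ι) (X : L) (f : ι → L) :
    S.herm X (∑ i ∈ s, f i) = ∑ i ∈ s, S.herm X (f i) := by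
  apply Complex.ext <;> simp [herm]

theorem herm_conj (X Y : L) : (starRingEnd ℂ) (S.herm X Y) = S.herm Y X := by
  apply Complex.ext
  · simp [herm, S.g_symm X Y]
  · simp [herm, S.g_J_left, S.g_symm X (S.J Y)]

variable {S} {n : ℕ} {e : Fin n → L}

/-- The basis `e₁, …, eₙ, J e₁, …, J eₙ`. -/
def frameVec (S : InvariantHermitian L) (e : Fin n → L) : Fin n ⊕ Fin n → L :=
  Sum.elim e fun i => S.J (e i)

theorem orthonormal_frameVec (h1 : ∀ i j, S.g (e i) (e j) = if i = j then 1 else 0)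
    (h2 : ∀ i j, S.g (e i) (S.J (e j)) = 0) : S.IsOrthonormal (frameVec S e) := by
  rintro (i | i) (j | j)
  · simpa [frameVec] using h1 i j
  · simpa [frameVec] using h2 i j
  · simpa [frameVec, S.g_J_left] using h2 i j
  · simpa [frameVec, S.g_J] using h1 i j

theorem IsOrthonormal.linearIndependent {ι : Type*} [Fintype ι] [DecidableEq ι] {b : ι → L}
    (hb : S.IsOrthonormal b) : LinearIndependent ℝ b := by
  rw [Fintype.linearIndependent_iff]
  intro c hc i
  have h := congrArg (S.g (b i)) hc
  rw [map_sum] at h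
  simpa [show ∀ j, S.g (b i) (b j) = _ from hb i] using h

theorem exists_unitary_family [FiniteDimensional ℝ L] (k : ℕ)
    (hk : 2 * k ≤ Module.finrank ℝ L) :
    ∃ e : Fin k → L, (∀ i j, S.g (e i) (e j) = if i = j then 1 else 0) ∧
      ∀ i j, S.g (e i) (S.J (e j)) = 0 := by
  induction k with
  | zero => exact ⟨fun i => i.elim0, fun i => i.elim0, fun i => i.elim0⟩
  | succ k ih =>
    obtain ⟨e, h1, h2⟩ := ih (by omega)
    -- Its kernel is the orthogonal complement of the complex span so far, nonzero since `2k < dim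
    -- L`; a normalized vector of it extends the frame.
    let ψ : L →ₗ[ℝ] (Fin k ⊕ Fin k → ℝ) := LinearMap.pi fun i => S.g (frameVec S e i)
    obtain ⟨X, hX, hX0⟩ : ∃ X, ψ X = 0 ∧ X ≠ 0 := by
      have : ¬Function.Injective ψ := fun hinj => by
        have := LinearMap.finrank_le_finrank_of_injective hinj
        simp at this
        omega
      rw [← LinearMap.ker_eq_bot, Submodule.eq_bot_iff] at this
      push Not at this
      exact this
    have ho : ∀ i, S.g (frameVec S e i) X = 0 := fun i => congrFun hX i
    have hp := S.g_pos X hX0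
    set r := (Real.sqrt (S.g X X))⁻¹ with hr
    have hr2 : r * (r * S.g X X) = 1 := by
      have h0 := Real.sqrt_pos.2 hp
      rw [hr]
      nth_rewrite 3 [← Real.mul_self_sqrt hp.le]
      field_simp
    have hl : ∀ i, S.g (e i) X = 0 := fun i => by simpa [frameVec] using ho (Sum.inl i)
    have hJ : ∀ i, S.g (S.J (e i)) X = 0 := fun i => by simpa [frameVec] using ho (Sum.inr i)
    have hXX : S.g X (S.J X) = 0 := by
      have := S.g_J_left X X
      rw [S.g_symm] at this
      linarith
    refine ⟨Fin.snoc (α := fun _ => L) e (r • X), fun i j => ?_, fun i j => ?_⟩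
    · induction i using Fin.lastCases <;> induction j using Fin.lastCases
      · simpa using hr2
      · simp [S.g_symm X, hl, (Fin.castSucc_lt_last _).ne']
      · simp [hl, (Fin.castSucc_lt_last _).ne]
      · simp [h1]
    · induction i using Fin.lastCases <;> induction j using Fin.lastCases
      · simp [hXX]
      · simp [S.g_symm X, hJ]
      · have := fun i => S.g_J_left (e i) X
        simp only [hJ, zero_eq_neg] at this
        simp [this]
      · simp [h2]

theorem exists_unitaryFrame (S : InvariantHermitian L) [FiniteDimensional ℝ L]
    (hn : Module.finrank ℝ L = 2 * n) : ∃ e : Fin n → L, S.IsUnitaryFrame e := by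
  obtain ⟨e, h1, h2⟩ := S.exists_unitary_family n hn.ge
  refine ⟨e, h1, h2, ?_⟩
  have h3 := (orthonormal_frameVec h1 h2).linearIndependent.span_eq_top_of_card_eq_finrank'
    (by simp [hn]; ring)
  rwa [frameVec, Set.Sum.elim_range] at h3

theorem IsUnitaryFrame.exists_basis (he : S.IsUnitaryFrame e) :
    ∃ b : Module.Basis (Fin n ⊕ Fin n) ℝ L, ⇑b = frameVec S e ∧ S.IsOrthonormal b := by
  have ho := orthonormal_frameVec he.1 he.2.1
  have hs : ⊤ ≤ Submodule.span ℝ (Set.range (frameVec S e)) := by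
    rw [frameVec, Set.Sum.elim_range, he.2.2]
  have hb : ⇑(Module.Basis.mk ho.linearIndependent hs) = frameVec S e := Module.Basis.coe_mk _ _
  exact ⟨_, hb, by rw [hb]; exact ho⟩

theorem IsUnitaryFrame.sum_eq (he : S.IsUnitaryFrame e) (X : L) :
    ∑ i, ((S.herm (e i) X).re • e i + (S.herm (e i) X).im • S.J (e i)) = X := by
  obtain ⟨b, hb, ho⟩ := he.exists_basis
  conv_rhs => rw [← ho.sum_smul X, hb]
  simp [frameVec, herm, Finset.sum_add_distrib]

theorem IsUnitaryFrame.herm_apply (he : S.IsUnitaryFrame e) {A : L →ₗ[ℝ] L}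
    (hA : ∀ X, A (S.J X) = S.J (A X)) (X Y : L) :
    S.herm X (A Y) = ∑ k, S.herm X (A (e k)) * S.herm (e k) Y := by
  conv_lhs => rw [← he.sum_eq Y]
  simp only [map_sum, map_add, map_smul, hA, herm_sum_right, herm_add_right, herm_smul_right,
    herm_J_right]
  refine Finset.sum_congr rfl fun k _ => ?_
  conv_rhs => rw [← Complex.re_add_im (S.herm (e k) Y)]
  ring

/-- The complex matrix of an endomorphism in a unitary frame. -/
def frameMatrix (S : InvariantHermitian L) (e : Fin n → L) (A : L →ₗ[ℝ] L) :
    Matrix (Fin n) (Fin n) ℂ := Matrix.of fun i j => S.herm (e i) (A (e j))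

theorem IsUnitaryFrame.herm_self (he : S.IsUnitaryFrame e) (i j : Fin n) :
    S.herm (e i) (e j) = (1 : Matrix (Fin n) (Fin n) ℂ) i j := by
  apply Complex.ext
  · rw [herm, he.1, Matrix.one_apply]
    split_ifs <;> simp
  · rw [herm, S.g_J_left, he.2.1, Matrix.one_apply]
    split_ifs <;> simp

theorem IsUnitaryFrame.frameMatrix_id (he : S.IsUnitaryFrame e) :
    frameMatrix S e LinearMap.id = 1 := by
  ext i j
  exact he.herm_self i j

theorem IsUnitaryFrame.frameMatrix_comp (he : S.IsUnitaryFrame e) {A : L →ₗ[ℝ] L}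
    (hA : ∀ X, A (S.J X) = S.J (A X)) (B : L →ₗ[ℝ] L) :
    frameMatrix S e (A ∘ₗ B) = frameMatrix S e A * frameMatrix S e B := by
  ext i j
  simp [frameMatrix, Matrix.mul_apply, he.herm_apply hA (e i) (B (e j))]

/-- A change of frame conjugates the matrix. `IsSpecialUnitary` only provides some frame, while
determinants are tracked in a fixed one. -/
theorem IsUnitaryFrame.det_frameMatrix (he : S.IsUnitaryFrame e) {f : Fin n → L}
    (hf : S.IsUnitaryFrame f) {A : L →ₗ[ℝ] L} (hA : ∀ X, A (S.J X) = S.J (A X)) :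
    (frameMatrix S e A).det = (frameMatrix S f A).det := by
  let P : Matrix (Fin n) (Fin n) ℂ := Matrix.of fun i j => S.herm (e i) (f j)
  let Q : Matrix (Fin n) (Fin n) ℂ := Matrix.of fun i j => S.herm (f i) (e j)
  have hPQ : P * Q = 1 := by
    ext i j
    rw [← he.herm_self, Matrix.mul_apply]
    exact (hf.herm_apply (A := LinearMap.id) (fun _ => rfl) (e i) (e j)).symm
  have h1 : frameMatrix S e A = P * frameMatrix S f A * Q := by
    ext i j
    rw [Matrix.mul_apply]
    refine (hf.herm_apply hA (e i) (e j)).trans (Finset.sum_congr rfl fun k _ => ?_)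
    congr 1
    rw [Matrix.mul_apply]
    exact hf.herm_apply (A := LinearMap.id) (fun _ => rfl) (e i) (A (f k))
  have h2 := congrArg Matrix.det hPQ
  rw [Matrix.det_mul, Matrix.det_one] at h2
  rw [h1, Matrix.det_mul, Matrix.det_mul, mul_right_comm, h2, one_mul]

theorem IsUnitaryFrame.det_eq_one (he : S.IsUnitaryFrame e) {A : L →ₗ[ℝ] L}
    (hA : S.IsSpecialUnitary n A) : (frameMatrix S e A).det = 1 := by
  obtain ⟨hJ, f, hf, U, hU, hUA⟩ := hA
  rw [he.det_frameMatrix hf hJ, ← (Matrix.mem_specialUnitaryGroup_iff.1 hU).2]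
  congr 1
  ext i j
  simp only [frameMatrix, Matrix.of_apply, hUA, herm_sum_right, herm_add_right, herm_smul_right,
    herm_J_right, hf.herm_self, Matrix.one_apply]
  rw [Finset.sum_eq_single i]
  · conv_rhs => rw [← Complex.re_add_im (U i j)]
    simp [mul_comm]
  · intro k _ hk
    simp [hk.symm]
  · simp

theorem IsUnitaryFrame.isSpecialUnitary (he : S.IsUnitaryFrame e) {A : L →ₗ[ℝ] L}
    (hJ : ∀ X, A (S.J X) = S.J (A X)) (hg : ∀ X Y, S.g (A X) (A Y) = S.g X Y)
    (hdet : (frameMatrix S e A).det = 1) : S.IsSpecialUnitary n A := by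
  refine ⟨hJ, e, he, frameMatrix S e A, ?_, fun j => (he.sum_eq (A (e j))).symm⟩
  rw [Matrix.mem_specialUnitaryGroup_iff]
  refine ⟨?_, hdet⟩
  rw [Matrix.mem_unitaryGroup_iff']
  ext i j
  have h1 : S.herm (A (e i)) (A (e j)) = S.herm (e i) (e j) := by
    simp [herm, ← hJ, hg]
  rw [← he.herm_self, ← h1, Matrix.mul_apply]
  refine Eq.trans (Finset.sum_congr rfl fun k _ => ?_)
    (he.herm_apply (A := LinearMap.id) (fun _ => rfl) (A (e i)) (A (e j))).symm
  rw [Matrix.star_apply]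
  congr 1
  exact S.herm_conj _ _

theorem IsUnitaryFrame.trace_frameMatrix (he : S.IsUnitaryFrame e) {A : L →ₗ[ℝ] L}
    (hA : ∀ X, S.g X (A X) = 0) (hJ : ∀ X, A (S.J X) = S.J (A X)) :
    (frameMatrix S e A).trace = -(Complex.I / 2) * (LinearMap.trace ℝ L (S.J ∘ₗ A) : ℝ) := by
  obtain ⟨b, hb, ho⟩ := he.exists_basis
  have h1 : LinearMap.trace ℝ L (S.J ∘ₗ A) = -2 * ∑ i, S.g (S.J (e i)) (A (e i)) := by
    rw [ho.trace_eq, hb]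
    simp [frameVec, hJ, S.J_sq, S.g_J_left]
    ring
  rw [h1, Matrix.trace]
  apply Complex.ext <;> simp [frameMatrix, herm, hA]

end Frames

end InvariantHermitian

namespace NilConnection

open InvariantHermitian

/-! ### Parallel transport of Hermitian connections -/

section Calculus

variable {m : ℕ} {G : Type*} [TopologicalSpace G]
    [ChartedSpace (EuclideanSpace ℝ (Fin m)) G] [Group G]

theorem hasDerivAt_linear {F : Type*} [NormedAddCommGroup F] [NormedSpace ℝ F]
    (ℓ : GroupLieAlgebra (𝓡 m) G →ₗ[ℝ] F) {f : ℝ → GroupLieAlgebra (𝓡 m) G}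
    {f' : GroupLieAlgebra (𝓡 m) G} {t : ℝ}
    (h : HasDerivAt (fun s => toModel (f s)) (toModel f') t) :
    HasDerivAt (fun s => ℓ (f s)) (ℓ f') t := by
  let ℓ' : EuclideanSpace ℝ (Fin m) →ₗ[ℝ] F := ℓ
  exact (LinearMap.toContinuousLinearMap ℓ').hasFDerivAt.comp_hasDerivAt t h

theorem hasDerivAt_bilin (B : LinearMap.BilinForm ℝ (GroupLieAlgebra (𝓡 m) G))
    {f h : ℝ → GroupLieAlgebra (𝓡 m) G} {f' h' : GroupLieAlgebra (𝓡 m) G} {t : ℝ}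
    (hf : HasDerivAt (fun s => toModel (f s)) (toModel f') t)
    (hh : HasDerivAt (fun s => toModel (h s)) (toModel h') t) :
    HasDerivAt (fun s => B (f s) (h s)) (B f' (h t) + B (f t) h') t := by
  let B' : EuclideanSpace ℝ (Fin m) →ₗ[ℝ] EuclideanSpace ℝ (Fin m) →ₗ[ℝ] ℝ := B
  let B'' : EuclideanSpace ℝ (Fin m) →L[ℝ] EuclideanSpace ℝ (Fin m) →L[ℝ] ℝ :=
    LinearMap.toContinuousLinearMap
      ((LinearMap.toContinuousLinearMap : _ ≃ₗ[ℝ] (EuclideanSpace ℝ (Fin m) →L[ℝ] ℝ)) ∘ₗ B')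
  have h1 : HasDerivAt (fun s => B'' (toModel (f s))) (B'' (toModel f')) t :=
    B''.hasFDerivAt.comp_hasDerivAt t hf
  exact h1.clm_apply hh

end Calculus

section Transport

variable {n : ℕ} {G : Type*} [TopologicalSpace G]
    [ChartedSpace (EuclideanSpace ℝ (Fin (2 * n))) G] [Group G] [LieGroup (𝓡 (2 * n)) ∞ G]
    {Γ : Subgroup G} {S : InvariantHermitian (GroupLieAlgebra (𝓡 (2 * n)) G)}
    {D : NilConnection (m := 2 * n) Γ}

theorem IsHermitian.isHermitianForm (hD : D.IsHermitian S) (p : LeftQuotient Γ) :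
    S.IsHermitianForm (D.form p) := ⟨hD.1 p, hD.2 p⟩

variable {c : ℝ → G} {u : ℝ → GroupLieAlgebra (𝓡 (2 * n)) G}
    {Φ : ℝ → GroupLieAlgebra (𝓡 (2 * n)) G →ₗ[ℝ] GroupLieAlgebra (𝓡 (2 * n)) G}

theorem IsHermitian.g_parallel (hD : D.IsHermitian S)
    {f h : ℝ → GroupLieAlgebra (𝓡 (2 * n)) G}
    (hf : ∀ t, HasDerivAt (fun s => toModel (f s))
      (-toModel (D.form (LeftQuotient.mk Γ (c t)) (u t) (f t))) t)
    (hh : ∀ t, HasDerivAt (fun s => toModel (h s))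
      (-toModel (D.form (LeftQuotient.mk Γ (c t)) (u t) (h t))) t) (t : ℝ) :
    S.g (f t) (h t) = S.g (f 0) (h 0) := by
  have h1 : ∀ t, HasDerivAt (fun s => S.g (f s) (h s)) 0 t := by
    intro t
    convert! hasDerivAt_bilin S.g
      (f' := -D.form (LeftQuotient.mk Γ (c t)) (u t) (f t))
      (h' := -D.form (LeftQuotient.mk Γ (c t)) (u t) (h t)) (hf t) (hh t) using 1
    have := hD.1 (LeftQuotient.mk Γ (c t)) (u t) (f t) (h t)
    simp only [map_neg, LinearMap.neg_apply]
    linarith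
  exact is_const_of_deriv_eq_zero (fun t => (h1 t).differentiableAt) (fun t => (h1 t).deriv) t 0

theorem IsHermitian.J_parallel (hD : D.IsHermitian S) (h0 : Φ 0 = LinearMap.id)
    (hΦ : ∀ (v : GroupLieAlgebra (𝓡 (2 * n)) G) (t : ℝ),
      HasDerivAt (fun s => toModel (Φ s v))
        (-toModel (D.form (LeftQuotient.mk Γ (c t)) (u t) (Φ t v))) t)
    (t : ℝ) (X : GroupLieAlgebra (𝓡 (2 * n)) G) : Φ t (S.J X) = S.J (Φ t X) := by
  -- The defect is itself parallel and starts at zero, so its constant norm is zero; no ODE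
  -- uniqueness theorem is required.
  let f : ℝ → GroupLieAlgebra (𝓡 (2 * n)) G := fun t => Φ t (S.J X) - S.J (Φ t X)
  have hf : ∀ t, HasDerivAt (fun s => toModel (f s))
      (-toModel (D.form (LeftQuotient.mk Γ (c t)) (u t) (f t))) t := by
    intro t
    let J' : GroupLieAlgebra (𝓡 (2 * n)) G →ₗ[ℝ] EuclideanSpace ℝ (Fin (2 * n)) := S.J
    have h1 := hasDerivAt_linear J' (f := fun s => Φ s X)
      (f' := -D.form (LeftQuotient.mk Γ (c t)) (u t) (Φ t X)) (hΦ X t)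
    convert! (hΦ (S.J X) t).sub h1 using 1
    change -(D.form (LeftQuotient.mk Γ (c t)) (u t) (Φ t (S.J X) - S.J (Φ t X))) =
      -(D.form (LeftQuotient.mk Γ (c t)) (u t) (Φ t (S.J X))) -
        S.J (-D.form (LeftQuotient.mk Γ (c t)) (u t) (Φ t X))
    rw [map_sub, map_neg, hD.2]
    abel
  have h1 := hD.g_parallel hf hf t
  have h2 : f 0 = 0 := by simp [f, h0]
  rw [h2, map_zero] at h1
  by_contra hne
  exact (S.g_pos _ (sub_ne_zero.2 hne)).ne' h1

theorem IsHermitian.hasDerivAt_det (hD : D.IsHermitian S)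
    {e : Fin n → GroupLieAlgebra (𝓡 (2 * n)) G} (he : S.IsUnitaryFrame e)
    (hΦ : ∀ (v : GroupLieAlgebra (𝓡 (2 * n)) G) (t : ℝ),
      HasDerivAt (fun s => toModel (Φ s v))
        (-toModel (D.form (LeftQuotient.mk Γ (c t)) (u t) (Φ t v))) t) (t : ℝ) :
    HasDerivAt (fun s => (frameMatrix S e (Φ s)).det)
      (Complex.I / 2 * (LinearMap.trace ℝ _
        (S.J ∘ₗ D.form (LeftQuotient.mk Γ (c t)) (u t)) : ℝ) *
        (frameMatrix S e (Φ t)).det) t := by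
  convert! hasDerivAt_det_of_linear (U := fun s => frameMatrix S e (Φ s))
    (W := frameMatrix S e (D.form (LeftQuotient.mk Γ (c t)) (u t))) (t := t) ?_ using 1
  · rw [he.trace_frameMatrix
      (fun X => IsHermitianForm.g_self (hD.isHermitianForm _) _ X) (hD.2 _ _)]
    ring
  · intro i j
    rw [← he.frameMatrix_comp (hD.2 _ _)]
    let ℓ : GroupLieAlgebra (𝓡 (2 * n)) G →ₗ[ℝ] ℂ :=
      { toFun := S.herm (e i)
        map_add' := S.herm_add_right _
        map_smul' := fun r X => by simp [S.herm_smul_right] }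
    have h1 := hasDerivAt_linear ℓ (f := fun s => Φ s (e j))
      (f' := -D.form (LeftQuotient.mk Γ (c t)) (u t) (Φ t (e j))) (hΦ (e j) t)
    rw [map_neg] at h1
    exact h1

/-- A Hermitian connection whose trace form vanishes has holonomy in `SU(n)`. -/
theorem IsHermitian.holonomyReducesToSU (hD : D.IsHermitian S)
    (h : ∀ p X, LinearMap.trace ℝ _ (S.J ∘ₗ D.form p X) = 0) : D.HolonomyReducesToSU S n := by
  obtain ⟨e, he⟩ := S.exists_unitaryFrame (n := n) (finrank_euclideanSpace_fin (𝕜 := ℝ))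
  rintro x A ⟨y, -, hA⟩
  have key : (∀ X, A (S.J X) = S.J (A X)) ∧ (∀ X Y, S.g (A X) (A Y) = S.g X Y) ∧
      (frameMatrix S e A).det = 1 := by
    induction hA with
    | refl => exact ⟨fun _ => rfl, fun _ _ => rfl, by rw [he.frameMatrix_id, Matrix.det_one]⟩
    | tail _ hB ih =>
      obtain ⟨h1, h2, h3⟩ := ih
      obtain ⟨c, u, Φ, -, -, -, -, h0, rfl, hΦ⟩ := hB
      have hJ := hD.J_parallel h0 hΦ 1
      refine ⟨fun X => ?_, fun X Y => ?_, ?_⟩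
      · simp [h1, hJ]
      · rw [LinearMap.comp_apply, LinearMap.comp_apply,
          hD.g_parallel (hΦ _) (hΦ _), h0]
        exact h2 X Y
      · have h4 : ∀ t, HasDerivAt (fun s => (frameMatrix S e (Φ s)).det) 0 t := fun t => by
          simpa [h] using hD.hasDerivAt_det he hΦ t
        have h5 := is_const_of_deriv_eq_zero (fun t => (h4 t).differentiableAt)
          (fun t => (h4 t).deriv) 1 0
        simp only [h0, he.frameMatrix_id, Matrix.det_one] at h5
        rw [he.frameMatrix_comp hJ, Matrix.det_mul, h3, h5, one_mul]
  exact he.isSpecialUnitary key.1 key.2.1 key.2.2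

end Transport

end NilConnection

/-! ### Existence of linear flows -/

section LinearODE

open Set Metric in
/-- A linear differential equation with small coefficients has a solution around `[0, 1]`. -/
theorem exists_linear_flow {F : Type*} [NormedAddCommGroup F] [NormedSpace ℝ F] [CompleteSpace F]
    {A : ℝ → F →L[ℝ] F} (hA : Continuous A) (hb : ∀ t, ‖A t‖ ≤ 1 / 4) :
    ∃ Φ : ℝ → F →L[ℝ] F, Φ 0 = ContinuousLinearMap.id ℝ F ∧
      ∀ t ∈ Icc (0 : ℝ) 1, HasDerivAt Φ (-(A t ∘L Φ t)) t := by
  have h0 : (0 : ℝ) ∈ Icc (-1 : ℝ) 2 := by norm_num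
  -- On the unit ball about the identity `‖x‖ ≤ 2`, so the field is at most `1/2`; over time at most
  -- `2` the solution stays in the ball. The interval exceeds `[0, 1]` to give two-sided derivatives
  -- at its ends.
  have hf : IsPicardLindelof (fun t (x : F →L[ℝ] F) => -(A t ∘L x)) (tmin := -1) (tmax := 2)
      ⟨0, h0⟩ (ContinuousLinearMap.id ℝ F) 1 0 (1 / 2) (1 / 4) := by
    refine ⟨fun t _ => ?_, fun x _ => ?_, fun t _ x hx => ?_, ?_⟩
    · refine LipschitzWith.lipschitzOnWith (LipschitzWith.of_dist_le_mul fun x y => ?_)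
      rw [dist_neg_neg, dist_eq_norm, dist_eq_norm, ← ContinuousLinearMap.comp_sub]
      refine (ContinuousLinearMap.opNorm_comp_le _ _).trans ?_
      gcongr
      simpa using hb t
    · exact (hA.clm_comp continuous_const).neg.continuousOn
    · have hx2 : ‖x‖ ≤ 2 := by
        have h1 : ‖x - ContinuousLinearMap.id ℝ F‖ ≤ 1 := by simpa [dist_eq_norm] using hx
        have h2 := norm_le_insert' x (ContinuousLinearMap.id ℝ F)
        have h3 := ContinuousLinearMap.norm_id_le (𝕜 := ℝ) (E := F)
        linarith
      rw [norm_neg]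
      refine (ContinuousLinearMap.opNorm_comp_le _ _).trans ?_
      calc ‖A t‖ * ‖x‖ ≤ 1 / 4 * 2 := by gcongr; exact hb t
        _ = _ := by norm_num
    · norm_num
  obtain ⟨Φ, hΦ0, hΦ⟩ := hf.exists_eq_forall_mem_Icc_hasDerivWithinAt₀
  exact ⟨Φ, hΦ0, fun t ht => (hΦ t ⟨by linarith [ht.1], by linarith [ht.2]⟩).hasDerivAt
    (Icc_mem_nhds (by linarith [ht.1]) (by linarith [ht.2]))⟩

end LinearODE

/-! ### Infinitesimal Stokes theorem on ellipses -/

section Circle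

open Real Filter Topology

variable {E : Type*} [NormedAddCommGroup E] [NormedSpace ℝ E]

/-- The ellipse with axes `a, b`. -/
def ellipse (a b : E) (τ : ℝ) : E := cos (2 * π * τ) • a + sin (2 * π * τ) • b

/-- The velocity of the ellipse with axes `a, b`. -/
def ellipseVel (a b : E) (τ : ℝ) : E :=
  (2 * π * cos (2 * π * τ)) • b - (2 * π * sin (2 * π * τ)) • a

theorem hasDerivAt_ellipse (a b : E) (τ : ℝ) :
    HasDerivAt (ellipse a b) (ellipseVel a b τ) τ := by
  have h0 : HasDerivAt (fun τ : ℝ => 2 * π * τ) (2 * π) τ := by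
    simpa using (hasDerivAt_id τ).const_mul (2 * π)
  convert! ((h0.cos).smul_const a).add ((h0.sin).smul_const b) using 1
  rw [ellipseVel, neg_mul, neg_smul, mul_comm (sin _), mul_comm (cos _), sub_eq_neg_add]

theorem contDiff_ellipse (a b : E) : ContDiff ℝ ∞ (ellipse a b) := by
  unfold ellipse
  fun_prop

theorem continuous_ellipseVel (a b : E) : Continuous (ellipseVel a b) := by
  unfold ellipseVel
  fun_prop

theorem ellipse_zero (a b : E) : ellipse a b 0 = a := by simp [ellipse]

theorem ellipse_one (a b : E) : ellipse a b 1 = a := by simp [ellipse]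

theorem norm_ellipse_le (a b : E) (τ : ℝ) : ‖ellipse a b τ‖ ≤ ‖a‖ + ‖b‖ := by
  refine (norm_add_le _ _).trans ?_
  rw [norm_smul, norm_smul]
  gcongr
  · exact mul_le_of_le_one_left (norm_nonneg _) (abs_cos_le_one _)
  · exact mul_le_of_le_one_left (norm_nonneg _) (abs_sin_le_one _)

theorem norm_ellipseVel_le (a b : E) (τ : ℝ) : ‖ellipseVel a b τ‖ ≤ 2 * π * (‖a‖ + ‖b‖) := by
  refine (norm_sub_le _ _).trans ?_
  rw [norm_smul, norm_smul, norm_mul (2 * π), norm_mul (2 * π),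
    norm_of_nonneg two_pi_pos.le, mul_add, add_comm]
  exact add_le_add
    (mul_le_mul_of_nonneg_right (mul_le_of_le_one_right two_pi_pos.le (abs_sin_le_one _))
      (norm_nonneg _))
    (mul_le_mul_of_nonneg_right (mul_le_of_le_one_right two_pi_pos.le (abs_cos_le_one _))
      (norm_nonneg _))

theorem integral_bilin_ellipse (B : E →L[ℝ] E →L[ℝ] ℝ) (a b : E) :
    ∫ τ in (0 : ℝ)..1, B (ellipse a b τ) (ellipseVel a b τ) = π * (B a b - B b a) := by
  -- An explicit primitive; only its linear term is not periodic.
  have hd : ∀ τ : ℝ, HasDerivAt (fun τ : ℝ => π * (B a b - B b a) * τ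
      + (B a b + B b a) / 2 * (sin (2 * π * τ) * cos (2 * π * τ))
      + (B b b - B a a) / 2 * (sin (2 * π * τ) * sin (2 * π * τ)))
      (B (ellipse a b τ) (ellipseVel a b τ)) τ := by
    intro τ
    have h0 : HasDerivAt (fun τ : ℝ => 2 * π * τ) (2 * π) τ := by
      simpa using (hasDerivAt_id τ).const_mul (2 * π)
    convert! (((hasDerivAt_id τ).const_mul (π * (B a b - B b a))).add
      ((h0.sin.mul h0.cos).const_mul ((B a b + B b a) / 2))).add
      ((h0.sin.mul h0.sin).const_mul ((B b b - B a a) / 2)) using 1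
    simp only [ellipse, ellipseVel, map_add, map_sub, map_smul, add_apply,
      smul_apply, smul_eq_mul]
    have := sin_sq_add_cos_sq (2 * π * τ)
    linear_combination (π * (B a b - B b a)) * this
  rw [intervalIntegral.integral_eq_sub_of_hasDerivAt (fun τ _ => hd τ)]
  · simp
  · have h1 := (contDiff_ellipse a b).continuous
    have h2 := continuous_ellipseVel a b
    exact Continuous.intervalIntegrable (by fun_prop) _ _

/-- If the integrals of a 1-form over all small ellipses around a point vanish, then its
derivative at the point is symmetric. -/
theorem fderiv_symm_of_integral_ellipse {σ : E → E →L[ℝ] ℝ} {x₀ : E}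
    {σ' : E →L[ℝ] E →L[ℝ] ℝ} (hσ : HasFDerivAt σ σ' x₀)
    (hc : ∀ᶠ x in 𝓝 x₀, ContinuousAt σ x) (a b : E)
    (h : ∀ᶠ ε in 𝓝[>] (0 : ℝ),
      ∫ τ in (0 : ℝ)..1, σ (x₀ + ε • ellipse a b τ) (ε • ellipseVel a b τ) = 0) :
    σ' a b = σ' b a := by
  set C := ‖a‖ + ‖b‖ with hC
  have hC0 : 0 ≤ C := by positivity
  have key : ∀ δ > 0, |π * (σ' a b - σ' b a)| ≤ δ * (C * (2 * π * C)) := by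
    intro δ hδ
    have h1 : ∀ᶠ x in 𝓝 x₀, ‖σ x - σ x₀ - σ' (x - x₀)‖ ≤ δ * ‖x - x₀‖ :=
      hσ.isLittleO.def hδ
    obtain ⟨r, hr, hball⟩ := Metric.eventually_nhds_iff.1 (h1.and hc)
    have h2 : ∀ᶠ ε in 𝓝[>] (0 : ℝ), ε * (C + 1) < r := by
      have : Tendsto (fun ε : ℝ => ε * (C + 1)) (𝓝 0) (𝓝 0) := by
        simpa using (continuous_mul_const (C + 1)).tendsto (0 : ℝ)
      exact (this.eventually (gt_mem_nhds hr)).filter_mono nhdsWithin_le_nhds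
    obtain ⟨ε, ⟨hε1, hε2⟩, hε⟩ := ((h.and h2).and self_mem_nhdsWithin).exists
    change 0 < ε at hε
    have hx : ∀ τ, dist (x₀ + ε • ellipse a b τ) x₀ < r := fun τ => by
      rw [dist_eq_norm, add_sub_cancel_left, norm_smul, Real.norm_of_nonneg hε.le]
      refine lt_of_le_of_lt ?_ hε2
      gcongr
      exact (norm_ellipse_le a b τ).trans (by linarith)
    have e1 := (contDiff_ellipse a b).continuous
    have e2 := continuous_ellipseVel a b
    have c1 : Continuous fun τ => σ (x₀ + ε • ellipse a b τ) := by
      rw [continuous_iff_continuousAt]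
      intro τ
      exact ContinuousAt.comp (f := fun τ => x₀ + ε • ellipse a b τ) (hball (hx τ)).2
        (by fun_prop)
    have c2 := c1.clm_apply e2
    have c3 : Continuous fun τ => σ x₀ (ellipseVel a b τ) := by fun_prop
    have c4 : Continuous fun τ => σ' (ε • ellipse a b τ) (ellipseVel a b τ) := by fun_prop
    have i0 : ∫ τ in (0 : ℝ)..1, σ x₀ (ellipseVel a b τ) = 0 := by
      rw [intervalIntegral.integral_eq_sub_of_hasDerivAt
        (fun τ _ => (σ x₀).hasFDerivAt.comp_hasDerivAt τ (hasDerivAt_ellipse a b τ))]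
      · simp [ellipse_zero, ellipse_one]
      · exact c3.intervalIntegrable _ _
    have i1 : ∫ τ in (0 : ℝ)..1, σ (x₀ + ε • ellipse a b τ) (ellipseVel a b τ) = 0 := by
      simp only [map_smul, smul_eq_mul, intervalIntegral.integral_const_mul] at hε1
      exact (mul_eq_zero.1 hε1).resolve_left hε.ne'
    -- The constant term integrates to zero over the loop and `σ` does so by hypothesis, leaving the
    -- antisymmetric part of `σ'`. The left side is `o(ε)`.
    have i2 : ∫ τ in (0 : ℝ)..1, (σ (x₀ + ε • ellipse a b τ) - σ x₀ - σ' (ε • ellipse a b τ))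
        (ellipseVel a b τ) = -(ε * (π * (σ' a b - σ' b a))) := by
      simp only [sub_apply]
      rw [intervalIntegral.integral_sub, intervalIntegral.integral_sub, i0, i1]
      · simp only [map_smul, smul_apply, smul_eq_mul,
          intervalIntegral.integral_const_mul, integral_bilin_ellipse]
        ring
      exacts [c2.intervalIntegrable _ _, c3.intervalIntegrable _ _,
        (c2.sub c3).intervalIntegrable _ _, c4.intervalIntegrable _ _]
    have i3 : ‖∫ τ in (0 : ℝ)..1,
        (σ (x₀ + ε • ellipse a b τ) - σ x₀ - σ' (ε • ellipse a b τ)) (ellipseVel a b τ)‖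
        ≤ δ * (ε * C) * (2 * π * C) * |1 - 0| := by
      refine intervalIntegral.norm_integral_le_of_norm_le_const fun τ _ => ?_
      refine (ContinuousLinearMap.le_opNorm _ _).trans ?_
      have h3 := (hball (hx τ)).1
      rw [add_sub_cancel_left, norm_smul, Real.norm_of_nonneg hε.le] at h3
      gcongr
      · exact h3.trans (by gcongr; exact norm_ellipse_le a b τ)
      · exact norm_ellipseVel_le a b τ
    rw [i2, norm_neg, norm_mul, Real.norm_of_nonneg hε.le, sub_zero, abs_one, mul_one,
      Real.norm_eq_abs] at i3
    refine le_of_mul_le_mul_left (i3.trans_eq ?_) hε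
    ring
  have h0 : |π * (σ' a b - σ' b a)| ≤ 0 := by
    refine le_of_forall_pos_le_add fun η hη => ?_
    have hK : 0 < C * (2 * π * C) + 1 := by positivity
    refine (key (η / (C * (2 * π * C) + 1)) (by positivity)).trans ?_
    rw [zero_add, div_mul_eq_mul_div, div_le_iff₀ hK]
    nlinarith
  have h1 := abs_nonpos_iff.1 h0
  have h2 := (mul_eq_zero.1 h1).resolve_left pi_ne_zero
  linarith

end Circle

theorem contDiffAt_clm_of_apply {E F H : Type*} [NormedAddCommGroup E] [NormedSpace ℝ E]
    [NormedAddCommGroup F] [NormedSpace ℝ F] [NormedAddCommGroup H] [NormedSpace ℝ H]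
    [FiniteDimensional ℝ E] {k : WithTop ℕ∞} {f : H → E →L[ℝ] F} {x : H}
    (h : ∀ y, ContDiffAt ℝ k (fun x => f x y) x) : ContDiffAt ℝ k f x := by
  let d := Module.finrank ℝ E
  have hd : d = Module.finrank ℝ (Fin d → ℝ) := (Module.finrank_fin_fun ℝ).symm
  let e₁ := ContinuousLinearEquiv.ofFinrankEq hd
  let e₂ := (e₁.arrowCongr (1 : F ≃L[ℝ] F)).trans (ContinuousLinearEquiv.piRing (Fin d))
  rw [← Function.id_comp f, ← e₂.symm_comp_self]
  exact e₂.symm.contDiff.contDiffAt.comp x (contDiffAt_pi.mpr fun i => h _)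

/-! ### The left-invariant frame in the chart at the identity -/

section ChartFrame

open VectorField Set Filter Topology

variable {m : ℕ} (G : Type*) [TopologicalSpace G]
    [ChartedSpace (EuclideanSpace ℝ (Fin m)) G] [Group G]

/-- The left-invariant frame in the chart at the identity: `chartFrame G x v` represents the value
at the point with coordinates `x` of the left-invariant vector field defined by `v`. -/
def chartFrame (x : EuclideanSpace ℝ (Fin m)) :
    EuclideanSpace ℝ (Fin m) →L[ℝ] EuclideanSpace ℝ (Fin m) :=
  ContinuousLinearMap.comp (M₂ := EuclideanSpace ℝ (Fin m))
    (ContinuousLinearMap.inverse (mfderivWithin 𝓘(ℝ, EuclideanSpace ℝ (Fin m)) (𝓡 m)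
      (extChartAt (𝓡 m) (1 : G)).symm (range (𝓡 m)) x))
    (mfderiv (𝓡 m) (𝓡 m) ((extChartAt (𝓡 m) (1 : G)).symm x * ·) (1 : G))

variable [LieGroup (𝓡 m) ∞ G]

theorem isInvertible_mfderiv_mul_left (g : G) :
    (mfderiv (𝓡 m) (𝓡 m) (g * ·) (1 : G)).IsInvertible := by
  have hd : ∀ a b : G, MDifferentiableAt (𝓡 m) (𝓡 m) (a * ·) b := fun a b =>
    (contMDiff_mul_left (I := 𝓡 m) (n := ∞)).contMDiffAt.mdifferentiableAt (by simp)
  have h1 : (mfderiv (𝓡 m) (𝓡 m) (g⁻¹ * ·) (g * 1)).comp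
      (mfderiv (𝓡 m) (𝓡 m) (g * ·) (1 : G)) = ContinuousLinearMap.id ℝ _ := by
    rw [← mfderiv_comp (1 : G) (hd _ _) (hd _ _)]
    have : (g⁻¹ * ·) ∘ (g * ·) = (id : G → G) := by ext x; simp
    rw [this, mfderiv_id]
  have h2 : (mfderiv (𝓡 m) (𝓡 m) (g * ·) (1 : G)).comp
      (mfderiv (𝓡 m) (𝓡 m) (g⁻¹ * ·) (g * 1)) = ContinuousLinearMap.id ℝ _ := by
    have hd' : MDifferentiableAt (𝓡 m) (𝓡 m) (g * ·) (g⁻¹ * (g * 1)) := hd _ _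
    have h3 := mfderiv_comp (g * 1) hd' (hd g⁻¹ (g * 1))
    have : (g * ·) ∘ (g⁻¹ * ·) = (id : G → G) := by ext x; simp
    rw [this, mfderiv_id] at h3
    rw [h3]
    congr 2
    simp
  exact ContinuousLinearMap.IsInvertible.of_inverse h2 h1

theorem isInvertible_chartFrame {x : EuclideanSpace ℝ (Fin m)}
    (hx : x ∈ (extChartAt (𝓡 m) (1 : G)).target) : (chartFrame G x).IsInvertible := by
  have : IsManifold (𝓡 m) 1 G := IsManifold.of_le (n := ∞) (by norm_cast)
  exact ContinuousLinearMap.IsInvertible.comp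
    (isInvertible_mfderivWithin_extChartAt_symm hx).inverse (isInvertible_mfderiv_mul_left G _)

theorem mfderivWithin_chartFrame {x : EuclideanSpace ℝ (Fin m)}
    (hx : x ∈ (extChartAt (𝓡 m) (1 : G)).target) (v : GroupLieAlgebra (𝓡 m) G) :
    mfderivWithin 𝓘(ℝ, EuclideanSpace ℝ (Fin m)) (𝓡 m) (extChartAt (𝓡 m) (1 : G)).symm
      (range (𝓡 m)) x (chartFrame G x (toModel v)) =
    mulInvariantVectorField v ((extChartAt (𝓡 m) (1 : G)).symm x) := by
  have : IsManifold (𝓡 m) 1 G := IsManifold.of_le (n := ∞) (by norm_cast)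
  exact (isInvertible_mfderivWithin_extChartAt_symm hx).self_apply_inverse _

/-- Applied to a fixed vector, the frame is the chart pullback of a left-invariant field, smooth
enough to lose one derivative; finite dimension passes this to the operator. -/
theorem contDiffAt_chartFrame :
    ContDiffAt ℝ 1 (chartFrame G : EuclideanSpace ℝ (Fin m) → _)
      (extChartAt (𝓡 m) (1 : G) 1) := by
  have : IsManifold (𝓡 m) (1 + 1) G := IsManifold.of_le (n := ∞) (by norm_cast)
  have h1 : ∀ v : EuclideanSpace ℝ (Fin m), ContDiffAt ℝ 1 (fun x => chartFrame G x v)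
      (extChartAt (𝓡 m) (1 : G) 1) := by
    intro v'
    let v : GroupLieAlgebra (𝓡 m) G := v'
    have hle : (1 : WithTop ℕ∞) ≤ minSmoothness ℝ 2 := by
      rw [minSmoothness_of_isRCLikeNormedField]
      exact one_le_two
    have hV : ContMDiffWithinAt (𝓡 m) (𝓡 m).tangent 1
        (fun g : G => (mulInvariantVectorField v g : TangentBundle (𝓡 m) G)) univ 1 :=
      ((contMDiffAt_mulInvariantVectorField (I := 𝓡 m) (G := G) v).of_le
        hle).contMDiffWithinAt
    have h2 := contMDiffWithinAt_vectorSpace_iff_contDiffWithinAt.1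
      (contMDiffWithinAt_mpullbackWithin_extChartAt_symm (n := 1 + 1) hV uniqueMDiffOn_univ
      (mem_univ _) le_rfl)
    refine h2.contDiffAt ?_
    simpa using extChartAt_target_mem_nhds (I := 𝓡 m) (1 : G)
  exact contDiffAt_clm_of_apply h1

/-- The bracket of the Lie algebra is by definition that of left-invariant fields at the identity,
computed in this chart; left translation by `1` has identity differential. -/
theorem chartFrame_lie (v w : GroupLieAlgebra (𝓡 m) G) :
    chartFrame G (extChartAt (𝓡 m) (1 : G) 1) (toModel ⁅v, w⁆) =
      lieBracket ℝ (E := EuclideanSpace ℝ (Fin m)) (fun x => chartFrame G x (toModel v))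
        (fun x => chartFrame G x (toModel w)) (extChartAt (𝓡 m) (1 : G) 1) := by
  have : IsManifold (𝓡 m) 1 G := IsManifold.of_le (n := ∞) (by norm_cast)
  have h1 : ⁅v, w⁆ = (mfderiv (𝓡 m) 𝓘(ℝ, EuclideanSpace ℝ (Fin m))
      (extChartAt (𝓡 m) (1 : G)) 1).inverse
      (lieBracket ℝ (E := EuclideanSpace ℝ (Fin m)) (fun x => chartFrame G x (toModel v))
        (fun x => chartFrame G x (toModel w)) (extChartAt (𝓡 m) (1 : G) 1)) := by
    rw [GroupLieAlgebra.bracket_def, ← mlieBracketWithin_univ, mlieBracketWithin_apply]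
    congr 1
    have h2 : ((extChartAt (𝓡 m) (1 : G)).symm ⁻¹' univ ∩ range (𝓡 m)) = univ := by simp
    rw [h2]
    exact congrFun (lieBracketWithin_univ (𝕜 := ℝ)
      (V := fun x => chartFrame G x (toModel v)) (W := fun x => chartFrame G x (toModel w))) _
  have h3 : ∀ u : GroupLieAlgebra (𝓡 m) G,
      mfderiv (𝓡 m) (𝓡 m) (1 * · : G → G) (1 : G) u = u := fun u => by
    have : (1 * · : G → G) = id := by ext x; simp
    rw [this, mfderiv_id]
    rfl
  have h4 : chartFrame G (extChartAt (𝓡 m) (1 : G) 1) (toModel ⁅v, w⁆) =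
      (mfderivWithin 𝓘(ℝ, EuclideanSpace ℝ (Fin m)) (𝓡 m)
      (extChartAt (𝓡 m) (1 : G)).symm (range (𝓡 m)) (extChartAt (𝓡 m) (1 : G) 1)).inverse
        (⁅v, w⁆ : GroupLieAlgebra (𝓡 m) G) := by
    conv_rhs => rw [← h3 ⁅v, w⁆]
    rw [chartFrame, extChartAt_to_inv]
    rfl
  rw [h4, h1]
  have h5 := mfderivWithin_extChartAt_symm_comp_mfderiv_extChartAt' (I := 𝓡 m)
    (mem_extChartAt_source (I := 𝓡 m) (1 : G))
  have h6 := mfderiv_extChartAt_comp_mfderivWithin_extChartAt_symm' (I := 𝓡 m)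
    (mem_extChartAt_source (I := 𝓡 m) (1 : G))
  refine (DFunLike.congr_fun (ContinuousLinearMap.inverse_eq h5 h6) _).trans ?_
  exact (isInvertible_mfderiv_extChartAt
    (mem_extChartAt_source (I := 𝓡 m) (1 : G))).self_apply_inverse _

end ChartFrame

namespace NilConnection

open Set Filter Topology InvariantHermitian

/-! ### Transport along short curves in the chart -/

section Loop

variable {m : ℕ} {G : Type*} [TopologicalSpace G]
    [ChartedSpace (EuclideanSpace ℝ (Fin m)) G] [Group G] {Γ : Subgroup G}

/-- The connection form at a point, as a continuous bilinear map of the model space. -/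
def formCLM (D : NilConnection (m := m) Γ) (p : LeftQuotient Γ) :
    EuclideanSpace ℝ (Fin m) →L[ℝ] EuclideanSpace ℝ (Fin m) →L[ℝ] EuclideanSpace ℝ (Fin m) :=
  let B : EuclideanSpace ℝ (Fin m) →ₗ[ℝ] EuclideanSpace ℝ (Fin m) →ₗ[ℝ]
    EuclideanSpace ℝ (Fin m) := D.form p
  LinearMap.toContinuousLinearMap
    ((LinearMap.toContinuousLinearMap :
      _ ≃ₗ[ℝ] (EuclideanSpace ℝ (Fin m) →L[ℝ] EuclideanSpace ℝ (Fin m))) ∘ₗ B)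

theorem formCLM_apply (D : NilConnection (m := m) Γ) (p : LeftQuotient Γ)
    (X Y : GroupLieAlgebra (𝓡 m) G) :
    D.formCLM p (toModel X) (toModel Y) = toModel (D.form p X Y) := rfl

variable [LieGroup (𝓡 m) ∞ G]

theorem continuousAt_formCLM (D : NilConnection (m := m) Γ) {x : EuclideanSpace ℝ (Fin m)}
    (hx : x ∈ (extChartAt (𝓡 m) (1 : G)).target) :
    ContinuousAt (fun x => D.formCLM (LeftQuotient.mk Γ ((extChartAt (𝓡 m) (1 : G)).symm x)))
      x := by
  refine (contDiffAt_clm_of_apply (k := ∞) fun X => contDiffAt_clm_of_apply fun Y =>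
    ?_).continuousAt
  have h1 : ContMDiffAt 𝓘(ℝ, EuclideanSpace ℝ (Fin m)) (𝓡 m) ∞
      (extChartAt (𝓡 m) (1 : G)).symm x :=
    (contMDiffOn_extChartAt_symm (n := ∞) (1 : G)).contMDiffAt
      ((isOpen_extChartAt_target (1 : G)).mem_nhds hx)
  exact contMDiffAt_iff_contDiffAt.1 (((D.smooth X Y).contMDiffAt).comp x h1)

theorem mfderiv_extChartAt_symm_comp {c : ℝ → EuclideanSpace ℝ (Fin m)}
    {c' : EuclideanSpace ℝ (Fin m)} {t : ℝ} (hc : HasDerivAt c c' t)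
    (ht : c t ∈ (extChartAt (𝓡 m) (1 : G)).target) :
    mfderiv 𝓘(ℝ, ℝ) (𝓡 m) (fun s => (extChartAt (𝓡 m) (1 : G)).symm (c s)) t (1 : ℝ) =
      mulInvariantVectorField (I := 𝓡 m) (G := G) ((chartFrame G (c t)).inverse c')
        ((extChartAt (𝓡 m) (1 : G)).symm (c t)) := by
  have : IsManifold (𝓡 m) 1 G := IsManifold.of_le (n := ∞) (by norm_cast)
  have h1 : MDifferentiableAt 𝓘(ℝ, EuclideanSpace ℝ (Fin m)) (𝓡 m)
      (extChartAt (𝓡 m) (1 : G)).symm (c t) :=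
    (mdifferentiableWithinAt_extChartAt_symm ht).mdifferentiableAt (by simp)
  have h2 := mfderivWithin_chartFrame G ht ((chartFrame G (c t)).inverse c')
  rw [← h2]
  have h3 : chartFrame G (c t) (toModel (G := G) ((chartFrame G (c t)).inverse c')) = c' :=
    (isInvertible_chartFrame G ht).self_apply_inverse _
  rw [h3, ModelWithCorners.range_eq_univ, mfderivWithin_univ]
  have h4 := mfderiv_comp t h1 hc.differentiableAt.mdifferentiableAt
  have h5 : mfderiv 𝓘(ℝ, ℝ) 𝓘(ℝ, EuclideanSpace ℝ (Fin m)) c t (1 : ℝ) = c' := by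
    rw [mfderiv_eq_fderiv]
    exact hc.deriv
  exact (DFunLike.congr_fun h4 (1 : ℝ)).trans
    (congrArg (mfderiv 𝓘(ℝ, EuclideanSpace ℝ (Fin m)) (𝓡 m)
      (extChartAt (𝓡 m) (1 : G)).symm (c t)) h5)

/-- Parallel transport along a short curve in the chart at the identity. -/
theorem exists_transport_of_chart_curve (D : NilConnection (m := m) Γ)
    {γ γ' : ℝ → EuclideanSpace ℝ (Fin m)} (hγ : ContDiff ℝ ∞ γ)
    (hγ' : ∀ τ, HasDerivAt γ (γ' τ) τ) (ht : ∀ τ, γ τ ∈ (extChartAt (𝓡 m) (1 : G)).target)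
    (hA : Continuous fun τ => D.formCLM
      (LeftQuotient.mk Γ ((extChartAt (𝓡 m) (1 : G)).symm (γ τ)))
      ((chartFrame G (γ τ)).inverse (γ' τ)))
    (hb : ∀ τ, ‖D.formCLM (LeftQuotient.mk Γ ((extChartAt (𝓡 m) (1 : G)).symm (γ τ)))
      ((chartFrame G (γ τ)).inverse (γ' τ))‖ ≤ 1 / 4) :
    ∃ (c : ℝ → G) (u : ℝ → GroupLieAlgebra (𝓡 m) G)
      (Φ : ℝ → GroupLieAlgebra (𝓡 m) G →ₗ[ℝ] GroupLieAlgebra (𝓡 m) G),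
      ContMDiff 𝓘(ℝ, ℝ) (𝓡 m) ∞ c ∧ c 0 = (extChartAt (𝓡 m) (1 : G)).symm (γ 0) ∧
      c 1 = (extChartAt (𝓡 m) (1 : G)).symm (γ 1) ∧
      (∀ t : ℝ, mfderiv 𝓘(ℝ, ℝ) (𝓡 m) c t (1 : ℝ) = mulInvariantVectorField (u t) (c t)) ∧
      Φ 0 = LinearMap.id ∧
      (∀ (v : GroupLieAlgebra (𝓡 m) G) (t : ℝ), HasDerivAt (fun s => toModel (Φ s v))
        (-toModel (D.form (LeftQuotient.mk Γ (c t)) (u t) (Φ t v))) t) ∧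
      ∀ t, toModel (u t) = deriv Real.smoothTransition t •
        (chartFrame G (γ (Real.smoothTransition t))).inverse
          (γ' (Real.smoothTransition t)) := by
  -- The flow is controlled only on `[0, 1]`, whereas `IsTransport` asks for the equation at all
  -- times. Reparametrizing by `Real.smoothTransition`, with values in `[0, 1]`, reconciles the two.
  obtain ⟨Ψ, hΨ0, hΨ⟩ := exists_linear_flow hA hb
  have hs : ∀ t, HasDerivAt Real.smoothTransition (deriv Real.smoothTransition t) t := fun t =>
    ((Real.smoothTransition.contDiff (n := 1)).differentiable one_ne_zero t).hasDerivAt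
  have hcs : ∀ t, HasDerivAt (fun t => γ (Real.smoothTransition t))
      (deriv Real.smoothTransition t • γ' (Real.smoothTransition t)) t := fun t =>
    (hγ' _).scomp t (hs t)
  let u : ℝ → GroupLieAlgebra (𝓡 m) G := fun t =>
    (chartFrame G (γ (Real.smoothTransition t))).inverse
      (deriv Real.smoothTransition t • γ' (Real.smoothTransition t))
  have hu : ∀ t, toModel (u t) = deriv Real.smoothTransition t •
        (chartFrame G (γ (Real.smoothTransition t))).inverse
          (γ' (Real.smoothTransition t)) := fun t =>
    map_smul (chartFrame G (γ (Real.smoothTransition t))).inverse _ _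
  let Φ : ℝ → GroupLieAlgebra (𝓡 m) G →ₗ[ℝ] GroupLieAlgebra (𝓡 m) G := fun t =>
    (Ψ (Real.smoothTransition t)).toLinearMap
  refine ⟨fun t => (extChartAt (𝓡 m) (1 : G)).symm (γ (Real.smoothTransition t)), u, Φ,
    ?_, by simp, by simp, fun t => mfderiv_extChartAt_symm_comp (hcs t) (ht _), ?_, ?_, hu⟩
  · exact (contMDiffOn_extChartAt_symm (n := ∞) (1 : G)).comp_contMDiff
      (hγ.comp Real.smoothTransition.contDiff).contMDiff fun t => ht _
  · simp only [Φ, Real.smoothTransition.zero, hΨ0]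
    rfl
  · intro v t
    have h1 := (hΨ (Real.smoothTransition t) ⟨Real.smoothTransition.nonneg t,
      Real.smoothTransition.le_one t⟩).scomp t (hs t)
    have h2 := h1.clm_apply (hasDerivAt_const t (toModel v))
    convert! h2 using 1
    rw [← formCLM_apply, hu, map_smul]
    simp
    rfl

end Loop

end NilConnection

/-! ### From trivial determinant holonomy to a closed trace form -/

open Filter Topology in
theorem eventually_norm_lt {X F : Type*} [TopologicalSpace X] [SeminormedAddCommGroup F]
    {f : X → F} {x : X} (h : ContinuousAt f x) : ∀ᶠ y in 𝓝 x, ‖f y‖ < ‖f x‖ + 1 :=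
  h.norm.eventually (gt_mem_nhds (lt_add_one _))

open Set Filter Topology Real in
/-- A linear form on the Lie algebra vanishes on brackets if the corresponding left-invariant
1-form has vanishing integrals over small ellipses around the identity. -/
theorem apply_lie_eq_zero_of_integral_ellipse {m : ℕ} {G : Type*} [TopologicalSpace G]
    [ChartedSpace (EuclideanSpace ℝ (Fin m)) G] [Group G] [LieGroup (𝓡 m) ∞ G]
    (α : EuclideanSpace ℝ (Fin m) →L[ℝ] ℝ)
    (h : ∀ a b : EuclideanSpace ℝ (Fin m), ∀ᶠ ε in 𝓝[>] (0 : ℝ), ∫ τ in (0 : ℝ)..1,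
      α ((chartFrame G (extChartAt (𝓡 m) (1 : G) 1 + ε • ellipse a b τ)).inverse
        (ε • ellipseVel a b τ)) = 0)
    (v w : GroupLieAlgebra (𝓡 m) G) : α (toModel ⁅v, w⁆) = 0 := by
  set x₀ : EuclideanSpace ℝ (Fin m) := extChartAt (𝓡 m) (1 : G) 1 with hx₀
  have hx₀t : x₀ ∈ (extChartAt (𝓡 m) (1 : G)).target := mem_extChartAt_target 1
  have hP : ContDiffAt ℝ 1 (chartFrame G) x₀ := contDiffAt_chartFrame G
  let σ : EuclideanSpace ℝ (Fin m) → EuclideanSpace ℝ (Fin m) →L[ℝ] ℝ :=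
    fun x => α ∘L (chartFrame G x).inverse
  have hσ : ContDiffAt ℝ 1 σ x₀ := by
    have h1 : ContDiffAt ℝ 1 (fun x => (chartFrame G x).inverse) x₀ :=
      (isInvertible_chartFrame G hx₀t).contDiffAt_map_inverse.comp x₀ hP
    exact contDiffAt_const.clm_comp h1
  have hσd := (hσ.differentiableAt one_ne_zero).hasFDerivAt
  have hPd := (hP.differentiableAt one_ne_zero).hasFDerivAt
  have hsymm := fderiv_symm_of_integral_ellipse hσd
    ((hσ.eventually (by simp)).mono fun x hx => hx.continuousAt)
    (chartFrame G x₀ (toModel v)) (chartFrame G x₀ (toModel w)) (h _ _)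
  -- Differentiating the constant `σ x (chartFrame G x y) = α y` turns the symmetry of `dσ` into
  -- vanishing on the bracket, as in Cartan's formula.
  have hconst : ∀ y z : EuclideanSpace ℝ (Fin m),
      fderiv ℝ σ x₀ z (chartFrame G x₀ y) + σ x₀ (fderiv ℝ (chartFrame G) x₀ z y) = 0 := by
    intro y z
    have h1 := hσd.clm_apply (hPd.clm_apply (hasFDerivAt_const y x₀))
    have h2 : (fun x => σ x (chartFrame G x y)) =ᶠ[𝓝 x₀] fun _ => α y := by
      filter_upwards [extChartAt_target_mem_nhds (I := 𝓡 m) (1 : G)] with x hx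
      exact congrArg α ((isInvertible_chartFrame G hx).inverse_apply_self y)
    have h3 := h1.unique ((hasFDerivAt_const (α y) x₀).congr_of_eventuallyEq h2)
    have h4 := DFunLike.congr_fun h3 z
    simpa [add_comm] using h4
  have hb : α (toModel ⁅v, w⁆) = σ x₀ (chartFrame G x₀ (toModel ⁅v, w⁆)) :=
    (congrArg α ((isInvertible_chartFrame G hx₀t).inverse_apply_self _)).symm
  have hl : ∀ u : GroupLieAlgebra (𝓡 m) G, ∀ z : EuclideanSpace ℝ (Fin m),
      fderiv ℝ (fun x => chartFrame G x (toModel u)) x₀ z =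
        fderiv ℝ (chartFrame G) x₀ z (toModel u) := fun u z => by
    rw [(hPd.clm_apply (hasFDerivAt_const (toModel u) x₀)).fderiv]
    simp
  rw [hb, chartFrame_lie, VectorField.lieBracket, ← hx₀, hl, hl, map_sub]
  have h1 := hconst (toModel w) (chartFrame G x₀ (toModel v))
  have h2 := hconst (toModel v) (chartFrame G x₀ (toModel w))
  linarith

namespace NilConnection

open Set Filter Topology InvariantHermitian

variable {n : ℕ} {G : Type*} [TopologicalSpace G]
    [ChartedSpace (EuclideanSpace ℝ (Fin (2 * n))) G] [Group G] [LieGroup (𝓡 (2 * n)) ∞ G]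
    {Γ : Subgroup G} {S : InvariantHermitian (GroupLieAlgebra (𝓡 (2 * n)) G)}
    {D : NilConnection (m := 2 * n) Γ}

/-- If the holonomy lies in `SU(n)`, the trace form integrates to zero over short loops. -/
theorem IsHermitian.integral_eq_zero_of_holonomyReducesToSU (hD : D.IsHermitian S)
    (h : D.HolonomyReducesToSU S n) (α : EuclideanSpace ℝ (Fin (2 * n)) →L[ℝ] ℝ)
    (hα : ∀ p X, LinearMap.trace ℝ _ (S.J ∘ₗ D.form p X) = α (toModel X))
    {γ γ' : ℝ → EuclideanSpace ℝ (Fin (2 * n))} (hγ : ContDiff ℝ ∞ γ)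
    (hγ' : ∀ τ, HasDerivAt γ (γ' τ) τ) (hloop : γ 0 = γ 1)
    (ht : ∀ τ, γ τ ∈ (extChartAt (𝓡 (2 * n)) (1 : G)).target)
    (hA : Continuous fun τ => D.formCLM
      (LeftQuotient.mk Γ ((extChartAt (𝓡 (2 * n)) (1 : G)).symm (γ τ)))
      ((chartFrame G (γ τ)).inverse (γ' τ)))
    (hb : ∀ τ, ‖D.formCLM (LeftQuotient.mk Γ ((extChartAt (𝓡 (2 * n)) (1 : G)).symm (γ τ)))
      ((chartFrame G (γ τ)).inverse (γ' τ))‖ ≤ 1 / 4)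
    (hβ : Continuous fun τ => α ((chartFrame G (γ τ)).inverse (γ' τ)))
    (hβb : ∀ τ, ‖α ((chartFrame G (γ τ)).inverse (γ' τ))‖ ≤ 1) :
    ∫ τ in (0 : ℝ)..1, α ((chartFrame G (γ τ)).inverse (γ' τ)) = 0 := by
  obtain ⟨e, he⟩ := S.exists_unitaryFrame (n := n) (finrank_euclideanSpace_fin (𝕜 := ℝ))
  obtain ⟨c, u, Φ, hc, hc0, hc1, hcu, hΦ0, hΦ, hu⟩ :=
    D.exists_transport_of_chart_curve hγ hγ' ht hA hb
  have hdet1 : (frameMatrix S e (Φ 1)).det = 1 := by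
    refine he.det_eq_one (h (c 0) _ ⟨c 0, rfl, ?_⟩)
    have h1 : D.IsTransport (c 0) (c 0) (Φ 1) :=
      ⟨c, u, Φ, hc, rfl, by rw [hc0, hc1, hloop], hcu, hΦ0, rfl, hΦ⟩
    exact IsPiecewiseTransport.tail .refl h1
  set β : ℝ → ℝ := fun τ => α ((chartFrame G (γ τ)).inverse (γ' τ)) with hβdef
  let F : ℝ → ℝ := fun τ => ∫ ξ in (0 : ℝ)..τ, β ξ
  have hF : ∀ τ, HasDerivAt F (β τ) τ := fun τ =>
    intervalIntegral.integral_hasDerivAt_right (hβ.intervalIntegrable _ _)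
      (hβ.stronglyMeasurableAtFilter _ _) hβ.continuousAt
  have hs : ∀ t, HasDerivAt Real.smoothTransition (deriv Real.smoothTransition t) t := fun t =>
    ((Real.smoothTransition.contDiff (n := 1)).differentiable one_ne_zero t).hasDerivAt
  have hαu : ∀ t, α (toModel (u t)) =
      deriv Real.smoothTransition t * β (Real.smoothTransition t) := fun t => by
    rw [hu, map_smul, smul_eq_mul]
  -- The integrating factor of the determinant equation; comparing the endpoints gives `exp(-(i/2) F
  -- 1) = 1`, hence `F 1 ∈ 4πℤ`.
  have hH : ∀ t, HasDerivAt (fun t => Complex.exp (-(Complex.I / 2) *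
      (F (Real.smoothTransition t) : ℝ)) * (frameMatrix S e (Φ t)).det) 0 t := by
    intro t
    have h1 := (((((hF (Real.smoothTransition t)).comp t (hs t)).ofReal_comp).const_mul
      (-(Complex.I / 2))).cexp).mul (hD.hasDerivAt_det he hΦ t)
    convert! h1 using 1
    rw [hα, hαu]
    simp only [Function.comp_apply]
    push_cast
    ring
  have h2 := is_const_of_deriv_eq_zero (fun t => (hH t).differentiableAt)
    (fun t => (hH t).deriv) 1 0
  have hF0 : F 0 = 0 := intervalIntegral.integral_same
  simp only [Real.smoothTransition.one, Real.smoothTransition.zero, hF0, hdet1, hΦ0,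
    he.frameMatrix_id, Matrix.det_one, Complex.ofReal_zero, mul_zero, Complex.exp_zero,
    mul_one] at h2
  obtain ⟨k, hk⟩ := Complex.exp_eq_one_iff.1 h2
  have hk2 : F 1 = -(4 * Real.pi * k) := by
    have h3 := congrArg Complex.im hk
    simp at h3
    linarith
  have hFb : |F 1| ≤ 1 := by
    have := intervalIntegral.norm_integral_le_of_norm_le_const (a := (0 : ℝ)) (b := 1)
      (f := β) (C := 1) fun τ _ => hβb τ
    simpa using this
  have hk0 : k = 0 := by
    by_contra hne
    have h3 : (1 : ℝ) ≤ |(k : ℝ)| := by exact_mod_cast Int.one_le_abs hne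
    rw [hk2, abs_neg, abs_mul, abs_of_pos (by positivity)] at hFb
    nlinarith [Real.pi_gt_three]
  change F 1 = 0
  rw [hk2, hk0]
  simp

theorem trace_lie_eq_zero (hD : D.IsHermitian S)
    (h : D.HolonomyReducesToSU S n) (α : EuclideanSpace ℝ (Fin (2 * n)) →L[ℝ] ℝ)
    (hα : ∀ p X, LinearMap.trace ℝ _ (S.J ∘ₗ D.form p X) = α (toModel X))
    (v w : GroupLieAlgebra (𝓡 (2 * n)) G) : α (toModel ⁅v, w⁆) = 0 := by
  refine apply_lie_eq_zero_of_integral_ellipse α (fun a b => ?_) v w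
  set x₀ : EuclideanSpace ℝ (Fin (2 * n)) := extChartAt (𝓡 (2 * n)) (1 : G) 1 with hx₀
  have hx₀t : x₀ ∈ (extChartAt (𝓡 (2 * n)) (1 : G)).target := mem_extChartAt_target 1
  let R : EuclideanSpace ℝ (Fin (2 * n)) →
    EuclideanSpace ℝ (Fin (2 * n)) →L[ℝ] EuclideanSpace ℝ (Fin (2 * n)) :=
    fun x => (chartFrame G x).inverse
  let B : EuclideanSpace ℝ (Fin (2 * n)) → EuclideanSpace ℝ (Fin (2 * n)) →L[ℝ]
      EuclideanSpace ℝ (Fin (2 * n)) →L[ℝ] EuclideanSpace ℝ (Fin (2 * n)) :=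
    fun x => D.formCLM (LeftQuotient.mk Γ ((extChartAt (𝓡 (2 * n)) (1 : G)).symm x))
  have hR : ContDiffAt ℝ 1 R x₀ :=
    (isInvertible_chartFrame G hx₀t).contDiffAt_map_inverse.comp x₀ (contDiffAt_chartFrame G)
  have hRc : ∀ᶠ x in 𝓝 x₀, ContinuousAt R x :=
    (hR.eventually (by simp)).mono fun x hx => hx.continuousAt
  have hRb : ∀ᶠ x in 𝓝 x₀, ‖R x‖ < ‖R x₀‖ + 1 :=
    eventually_norm_lt hR.continuousAt
  have hBc : ContinuousAt B x₀ := continuousAt_formCLM D hx₀t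
  have hBb : ∀ᶠ x in 𝓝 x₀, ‖B x‖ < ‖B x₀‖ + 1 :=
    eventually_norm_lt (F := EuclideanSpace ℝ (Fin (2 * n)) →L[ℝ]
      EuclideanSpace ℝ (Fin (2 * n)) →L[ℝ] EuclideanSpace ℝ (Fin (2 * n))) hBc
  obtain ⟨r, hr, hball⟩ := Metric.eventually_nhds_iff.1
    ((hRc.and hRb).and (hBb.and (extChartAt_target_mem_nhds (I := 𝓡 (2 * n)) (1 : G))))
  have hsmall : ∀ K δ : ℝ, 0 < δ → ∀ᶠ ε in 𝓝[>] (0 : ℝ), ε * K < δ := fun K δ hδ => by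
    have : Tendsto (fun ε : ℝ => ε * K) (𝓝 0) (𝓝 0) := by
      simpa using (continuous_mul_const K).tendsto (0 : ℝ)
    exact (this.eventually (gt_mem_nhds hδ)).filter_mono nhdsWithin_le_nhds
  set C := ‖a‖ + ‖b‖ with hC
  set C' := 2 * Real.pi * C with hC'
  have hC0 : 0 ≤ C := by positivity
  have hC'0 : 0 ≤ C' := by positivity
  -- Three smallness conditions: the ellipse stays in the good ball, the transport equation has
  -- coefficient at most `1/4`, and `α` along the curve is at most `1`.
  filter_upwards [hsmall (C + 1) r hr, hsmall ((‖B x₀‖ + 1) * ((‖R x₀‖ + 1) * C')) (1 / 4)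
    (by norm_num), hsmall (‖α‖ * ((‖R x₀‖ + 1) * C')) 1 one_pos, self_mem_nhdsWithin]
    with ε hε1 hε2 hε3 hε
  change 0 < ε at hε
  have hx : ∀ τ, dist (x₀ + ε • ellipse a b τ) x₀ < r := fun τ => by
    rw [dist_eq_norm, add_sub_cancel_left, norm_smul, Real.norm_of_nonneg hε.le]
    refine lt_of_le_of_lt ?_ hε1
    gcongr
    exact (norm_ellipse_le a b τ).trans (by linarith)
  have e1 := (contDiff_ellipse a b).continuous
  have e2 := continuous_ellipseVel a b
  have cγ : Continuous fun τ => x₀ + ε • ellipse a b τ := by fun_prop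
  have cR : Continuous fun τ => R (x₀ + ε • ellipse a b τ) := by
    rw [continuous_iff_continuousAt]
    exact fun τ => ContinuousAt.comp (f := fun τ => x₀ + ε • ellipse a b τ)
      (hball (hx τ)).1.1 cγ.continuousAt
  have cB : Continuous fun τ => B (x₀ + ε • ellipse a b τ) := by
    rw [continuous_iff_continuousAt]
    exact fun τ => ContinuousAt.comp (f := fun τ => x₀ + ε • ellipse a b τ)
      (continuousAt_formCLM D (hball (hx τ)).2.2) cγ.continuousAt
  have cRv : Continuous fun τ => R (x₀ + ε • ellipse a b τ) (ε • ellipseVel a b τ) :=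
    cR.clm_apply (e2.const_smul ε)
  have bRv : ∀ τ, ‖R (x₀ + ε • ellipse a b τ) (ε • ellipseVel a b τ)‖
      ≤ ε * ((‖R x₀‖ + 1) * C') := fun τ => by
    rw [map_smul, norm_smul, Real.norm_of_nonneg hε.le]
    gcongr
    refine (ContinuousLinearMap.le_opNorm _ _).trans ?_
    gcongr
    · exact (hball (hx τ)).1.2.le
    · exact norm_ellipseVel_le a b τ
  refine hD.integral_eq_zero_of_holonomyReducesToSU h α hα
    (γ := fun τ => x₀ + ε • ellipse a b τ) (γ' := fun τ => ε • ellipseVel a b τ)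
    (contDiff_const.add ((contDiff_ellipse a b).const_smul ε))
    (fun τ => ((hasDerivAt_ellipse a b τ).const_smul ε).const_add x₀)
    (by simp [ellipse_zero, ellipse_one]) (fun τ => (hball (hx τ)).2.2)
    (cB.clm_apply cRv) (fun τ => ?_) (α.continuous.comp cRv) fun τ => ?_
  · refine (ContinuousLinearMap.le_opNorm _ _).trans ?_
    refine (mul_le_mul (hball (hx τ)).2.1.le (bRv τ) (norm_nonneg _) (by positivity)).trans ?_
    linarith
  · refine (ContinuousLinearMap.le_opNorm _ _).trans ?_
    refine (mul_le_mul_of_nonneg_left (bRv τ) (norm_nonneg _)).trans ?_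
    linarith

/-- If the trace form of a Hermitian connection is a nonzero multiple of `d^*Ω`, then its holonomy
reduces to `SU(n)` if and only if the metric is balanced. -/
theorem holonomyReducesToSU_iff_of_trace [LieRing.IsNilpotent (GroupLieAlgebra (𝓡 (2 * n)) G)]
    (hD : D.IsHermitian S) {κ : ℝ} (hκ : κ ≠ 0)
    (htr : ∀ p X, LinearMap.trace ℝ _ (S.J ∘ₗ D.form p X) = κ * S.codiffFundamentalForm X) :
    D.HolonomyReducesToSU S n ↔ S.IsBalanced := by
  rw [S.isBalanced_iff]
  constructor
  · intro h
    obtain ⟨e, he⟩ := S.exists_unitaryFrame (n := n) (finrank_euclideanSpace_fin (𝕜 := ℝ))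
    obtain ⟨b, -, hb⟩ := he.exists_basis
    -- The connection form may vary with the point, but by `htr` its trace form does not, so one
    -- point defines a left-invariant 1-form.
    let p₀ := LeftQuotient.mk Γ 1
    let α' : GroupLieAlgebra (𝓡 (2 * n)) G →ₗ[ℝ] ℝ :=
      LinearMap.trace ℝ _ ∘ₗ LinearMap.llcomp ℝ _ _ _ S.J ∘ₗ D.form p₀
    let α'' : EuclideanSpace ℝ (Fin (2 * n)) →ₗ[ℝ] ℝ := α'
    refine hb.codiff_eq_zero fun X Y => ?_
    have h1 := trace_lie_eq_zero hD h (LinearMap.toContinuousLinearMap α'')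
      (fun p Z => by rw [htr p, ← htr p₀]; rfl) X Y
    have h2 : LinearMap.trace ℝ _ (S.J ∘ₗ D.form p₀ ⁅X, Y⁆) = 0 := h1
    rw [htr] at h2
    exact (mul_eq_zero.1 h2).resolve_left hκ
  · intro h
    exact hD.holonomyReducesToSU fun p X => by rw [htr, h, mul_zero]

end NilConnection

end

/-! ### The Bismut connection and the canonical family -/

theorem mainTheorem6 {n : ℕ} {G : Type*} [TopologicalSpace G] [T2Space G]
    [ChartedSpace (EuclideanSpace ℝ (Fin (2 * n))) G] [Group G] [LieGroup (𝓡 (2 * n)) ∞ G]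
    [SimplyConnectedSpace G] [LieRing.IsNilpotent (GroupLieAlgebra (𝓡 (2 * n)) G)]
    (Γ : Subgroup G) [DiscreteTopology Γ] [CompactSpace (LeftQuotient Γ)]
    (S : InvariantHermitian (GroupLieAlgebra (𝓡 (2 * n)) G))
    (D : NilConnection (m := 2 * n) Γ) :
    (D.IsBismut S → (D.HolonomyReducesToSU S n ↔ S.IsBalanced)) ∧
    (∀ t : ℝ, t ≠ 1 → D.IsCanonical S t → (D.HolonomyReducesToSU S n ↔ S.IsBalanced)) := by
  obtain ⟨e, he⟩ := S.exists_unitaryFrame (n := n) (finrank_euclideanSpace_fin (𝕜 := ℝ))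
  obtain ⟨b, -, hb⟩ := he.exists_basis
  have hbis : ∀ B : NilConnection (m := 2 * n) Γ, B.IsBismut S → ∀ p X,
      LinearMap.trace ℝ _ (S.J ∘ₗ B.form p X) = -2 * S.codiffFundamentalForm X := by
    intro B hB p X
    refine (hB.1.isHermitianForm p).trace_J_of_bismut hb (fun X Y Z => ?_) X
    simpa [InvariantHermitian.torsionForm_apply, NilConnection.torsion] using hB.2 p X Y Z
  refine ⟨fun hD => NilConnection.holonomyReducesToSU_iff_of_trace hD.1 (by norm_num)
    (hbis D hD), ?_⟩
  rintro t ht ⟨C, B, hC, hB, hCB⟩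
  have hchern : ∀ p X, LinearMap.trace ℝ _ (S.J ∘ₗ C.form p X) = 0 := by
    intro p X
    refine (hC.1.isHermitianForm p).trace_J_of_chern hb (fun X Y => ?_) X
    simpa [InvariantHermitian.torsionForm_apply, NilConnection.torsion] using hC.2 p X Y
  -- Chern contributes `0` and Bismut `-2` with weight `(1 - t)/2`, so the factor is nonzero exactly
  -- when `t ≠ 1`.
  refine NilConnection.holonomyReducesToSU_iff_of_trace (κ := -(1 - t)) ⟨fun p X Y Z => ?_,
    fun p X Y => ?_⟩ (neg_ne_zero.2 (sub_ne_zero.2 ht.symm)) fun p X => ?_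
  · have h1 := hC.1.1 p X Y Z
    have h2 := hB.1.1 p X Y Z
    simp only [hCB, map_add, map_smul, LinearMap.add_apply, LinearMap.smul_apply, smul_eq_mul]
    linear_combination (1 + t) / 2 * h1 + (1 - t) / 2 * h2
  · simp only [hCB, hC.1.2, hB.1.2, map_add, map_smul]
  · have h1 : S.J ∘ₗ D.form p X = ((1 + t) / 2) • (S.J ∘ₗ C.form p X)
        + ((1 - t) / 2) • (S.J ∘ₗ B.form p X) := by
      ext Y
      simp [hCB]
    rw [h1, map_add, map_smul, map_smul, hchern, hbis B hB, smul_zero, smul_eq_mul]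
    ring
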